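/- Let $\mathbb D$ be the open unit disc of $\mathbb C$. For a weight $v$ (a bounded, continuous, positive function on $\mathbb D$) let $\mathcal B^v$ be the Banach space of holomorphic $f:\mathbb D\to\mathbb C$ with $\|f\|_{\mathcal B^v}=|f(0)|+\sup_{z\in\mathbb D}v(z)|f'(z)|<\infty$. Put $$v_{\log}(z)=(1-|z|)\log\frac{2}{1-|z|},\qquad w_{\log}(z)=\Bigl[\log\log\frac{4}{1-|z|^2}\Bigr]^{-1},\qquad g_n(z)=z^n .$$ For holomorphic $u:\mathbb D\to\mathbb C$ and $\varphi:\mathbb D\to\mathbb D$ put $W_{u,\varphi}f=u\cdot(f\circ\varphi)$ and, for holomorphic $f$, $$I_u f(z)=\int_0^z f'(s)u(s)\,ds,\qquad J_u f(z)=\int_0^z f(s)u'(s)\,ds .$$ The essential norm $\|T\|_e$ of a bounded operator $T$ on $\mathcal B^{v_{\log}}$ is the infimum of $\|T-K\|$ over all compact operators $K$ on $\mathcal B^{v_{\log}}$. **Theorem.** There is an absolute constant $C>0$ such that, for all holomorphic $u:\mathbb D\to\mathbb C$ and $\varphi:\mathbb D\to\mathbb D$ for which $W_{u,\varphi}$ is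 a bounded operator $\mathcal B^{v_{\log}}\to\mathcal B^{v_{\log}}$, $$\frac1C\,\|W_{u,\varphi}\|_e\ \le\ \max\left\{\limsup_{n\to\infty}\frac{(n+1)\|J_u(\varphi^n)\|_{\mathcal B^{v_{\log}}}}{\|g_{n+1}\|_{\mathcal B^{w_{\log}}}},\ \limsup_{n\to\infty}\frac{\|I_u(\varphi^n)\|_{\mathcal B^{v_{\log}}}}{\|g_n\|_{\mathcal B^{v_{\log}}}}\right\}\ \le\ C\,\|W_{u,\varphi}\|_e .$$ Moreover, such a bounded $W_{u,\varphi}$ is compact on $\mathcal B^{v_{\log}}$ if and only if $$\lim_{n\to\infty}\frac{(n+1)\|J_u(\varphi^n)\|_{\mathcal B^{v_{\log}}}}{\|g_{n+1}\|_{\mathcal B^{w_{\log}}}}=0\quad\text{and}\quad\lim_{n\to\infty}\frac{\|I_u(\varphi^n)\|_{\mathcal B^{v_{\log}}}}{\|g_n\|_{\mathcal B^{v_{\log}}}}=0 .$$ -/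

import Mathlib

open Complex Filter Topology
open scoped Complex.UnitDisc ENNReal NNReal

noncomputable section

namespace LogBloch

/-- The extension by zero to `ℂ` of a function on the open unit disc. -/
def ext (f : 𝔻 → ℂ) : ℂ → ℂ := Function.extend (fun z : 𝔻 => (z : ℂ)) f 0

/-- `f` is holomorphic on the open unit disc. -/
def IsHolo (f : 𝔻 → ℂ) : Prop := DifferentiableOn ℂ (ext f) (Metric.ball 0 1)

/-- The complex derivative `f'` of a function on the open unit disc. -/
def cderiv (f : 𝔻 → ℂ) : 𝔻 → ℂ := fun z => deriv (ext f) z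

/-- The integral `∫₀ᶻ F(s) ds` along the segment from `0` to `z`. -/
def prim (F : 𝔻 → ℂ) : 𝔻 → ℂ :=
  fun z => ∫ t in (0 : ℝ)..1, ext F ((t : ℂ) * (z : ℂ)) * (z : ℂ)

/-- `I_u f (z) = ∫₀ᶻ f'(s) u(s) ds`. -/
def opI (u f : 𝔻 → ℂ) : 𝔻 → ℂ := prim (fun s => cderiv f s * u s)

/-- `J_u f (z) = ∫₀ᶻ f(s) u'(s) ds`. -/
def opJ (u f : 𝔻 → ℂ) : 𝔻 → ℂ := prim (fun s => f s * cderiv u s)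

/-- The weighted composition `W_{u,φ} f = u · (f ∘ φ)`. -/
def weightedComp (u : 𝔻 → ℂ) (φ : 𝔻 → 𝔻) (f : 𝔻 → ℂ) : 𝔻 → ℂ := fun z => u z * f (φ z)

/-- A weight: a bounded, continuous, positive function on the unit disc. -/
structure Weight where
  toFun : 𝔻 → ℝ
  continuous : Continuous toFun
  bounded : ∃ C : ℝ, ∀ z, toFun z ≤ C
  pos : ∀ z, 0 < toFun z

/-- `‖f‖_{B^v} = |f(0)| + sup_{z ∈ 𝔻} v(z) |f'(z)|`, possibly infinite. -/
def blochENorm (v : Weight) (f : 𝔻 → ℂ) : ℝ≥0∞ :=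
  ‖f 0‖ₑ + ⨆ z : 𝔻, ENNReal.ofReal (v.toFun z) * ‖cderiv f z‖ₑ

lemma ext_coe (f : 𝔻 → ℂ) (z : 𝔻) : ext f z = f z :=
  UnitDisc.coe_injective.extend_apply f 0 z

lemma ext_zero : ext 0 = 0 := by
  funext w
  by_cases h : ∃ a : 𝔻, (a : ℂ) = w
  · obtain ⟨a, rfl⟩ := h
    simp [ext_coe]
  · simp [ext, Function.extend_apply' _ _ _ h]

lemma ext_add (f g : 𝔻 → ℂ) : ext (f + g) = ext f + ext g := by
  funext w
  by_cases h : ∃ a : 𝔻, (a : ℂ) = w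
  · obtain ⟨a, rfl⟩ := h
    simp [ext_coe]
  · simp [ext, Function.extend_apply' _ _ _ h]

lemma ext_smul (c : ℂ) (f : 𝔻 → ℂ) : ext (c • f) = c • ext f := by
  funext w
  by_cases h : ∃ a : 𝔻, (a : ℂ) = w
  · obtain ⟨a, rfl⟩ := h
    simp [ext_coe]
  · simp [ext, Function.extend_apply' _ _ _ h]

lemma coe_mem_ball (z : 𝔻) : (z : ℂ) ∈ Metric.ball (0 : ℂ) 1 := by
  simpa using z.norm_lt_one

lemma IsHolo.differentiableAt {f : 𝔻 → ℂ} (hf : IsHolo f) (z : 𝔻) :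
    DifferentiableAt ℂ (ext f) z :=
  DifferentiableOn.differentiableAt hf (Metric.isOpen_ball.mem_nhds (coe_mem_ball z))

lemma isHolo_zero : IsHolo 0 := by
  rw [IsHolo, ext_zero]
  exact differentiableOn_const 0

lemma IsHolo.add {f g : 𝔻 → ℂ} (hf : IsHolo f) (hg : IsHolo g) : IsHolo (f + g) := by
  rw [IsHolo, ext_add]
  exact DifferentiableOn.add hf hg

lemma IsHolo.smul (c : ℂ) {f : 𝔻 → ℂ} (hf : IsHolo f) : IsHolo (c • f) := by
  rw [IsHolo, ext_smul]
  exact DifferentiableOn.const_smul hf c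

lemma cderiv_add {f g : 𝔻 → ℂ} (hf : IsHolo f) (hg : IsHolo g) (z : 𝔻) :
    cderiv (f + g) z = cderiv f z + cderiv g z := by
  rw [cderiv, ext_add]
  exact deriv_add (hf.differentiableAt z) (hg.differentiableAt z)

lemma cderiv_smul (c : ℂ) {f : 𝔻 → ℂ} (hf : IsHolo f) (z : 𝔻) :
    cderiv (c • f) z = c * cderiv f z := by
  rw [cderiv, ext_smul]
  exact deriv_const_smul c (hf.differentiableAt z)

lemma blochENorm_zero (v : Weight) : blochENorm v 0 = 0 := by
  have h : ∀ z : 𝔻, cderiv 0 z = 0 := by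
    intro z
    rw [cderiv, ext_zero]
    exact deriv_const _ _
  simp [blochENorm, h]

lemma blochENorm_add_le (v : Weight) {f g : 𝔻 → ℂ} (hf : IsHolo f) (hg : IsHolo g) :
    blochENorm v (f + g) ≤ blochENorm v f + blochENorm v g := by
  unfold blochENorm
  rw [add_add_add_comm]
  refine add_le_add (enorm_add_le _ _) (iSup_le fun z => ?_)
  rw [cderiv_add hf hg]
  calc ENNReal.ofReal (v.toFun z) * ‖cderiv f z + cderiv g z‖ₑ
      ≤ ENNReal.ofReal (v.toFun z) * (‖cderiv f z‖ₑ + ‖cderiv g z‖ₑ) := by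
        gcongr
        exact enorm_add_le _ _
    _ = ENNReal.ofReal (v.toFun z) * ‖cderiv f z‖ₑ
        + ENNReal.ofReal (v.toFun z) * ‖cderiv g z‖ₑ := mul_add _ _ _
    _ ≤ _ := add_le_add
        (le_iSup (fun z : 𝔻 => ENNReal.ofReal (v.toFun z) * ‖cderiv f z‖ₑ) z)
        (le_iSup (fun z : 𝔻 => ENNReal.ofReal (v.toFun z) * ‖cderiv g z‖ₑ) z)

lemma blochENorm_smul (v : Weight) (c : ℂ) {f : 𝔻 → ℂ} (hf : IsHolo f) :
    blochENorm v (c • f) = ‖c‖ₑ * blochENorm v f := by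
  unfold blochENorm
  rw [mul_add, ENNReal.mul_iSup]
  congr 1
  · simp [enorm_mul]
  · refine iSup_congr fun z => ?_
    rw [cderiv_smul c hf, enorm_mul, mul_left_comm]

/-- The Bloch-type space `B^v` as a linear subspace of the functions on the disc: holomorphic
functions with `‖f‖_{B^v} < ∞`. -/
def blochSubmodule (v : Weight) : Submodule ℂ (𝔻 → ℂ) where
  carrier := {f | IsHolo f ∧ blochENorm v f < ∞}
  zero_mem' := ⟨isHolo_zero, by simp [blochENorm_zero]⟩
  add_mem' := fun hf hg => ⟨hf.1.add hg.1,
    (blochENorm_add_le v hf.1 hg.1).trans_lt (ENNReal.add_lt_top.2 ⟨hf.2, hg.2⟩)⟩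
  smul_mem' := fun c _ hf => ⟨hf.1.smul c, by
    rw [blochENorm_smul v c hf.1]
    exact ENNReal.mul_lt_top enorm_lt_top hf.2⟩

/-- The Bloch-type space `B^v`, a type of its own so that it carries the topology of its norm
(and not that of pointwise convergence). -/
def Bloch (v : Weight) : Type := blochSubmodule v

instance (v : Weight) : AddCommGroup (Bloch v) := inferInstanceAs (AddCommGroup (blochSubmodule v))

instance (v : Weight) : Module ℂ (Bloch v) := inferInstanceAs (Module ℂ (blochSubmodule v))

instance (v : Weight) : CoeFun (Bloch v) (fun _ => 𝔻 → ℂ) := ⟨fun f => f.1⟩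

/-- A holomorphic function of norm zero vanishes. -/
lemma eq_zero_of_blochENorm (v : Weight) {f : 𝔻 → ℂ} (hf : IsHolo f)
    (h : blochENorm v f = 0) : f = 0 := by
  rw [blochENorm, add_eq_zero, enorm_eq_zero, ENNReal.iSup_eq_zero] at h
  have hd : ∀ z : 𝔻, cderiv f z = 0 := by
    intro z
    have := h.2 z
    rw [mul_eq_zero, ENNReal.ofReal_eq_zero, enorm_eq_zero] at this
    exact this.resolve_left (not_le.2 (v.pos z))
  funext z
  have hc := Metric.isOpen_ball.is_const_of_deriv_eq_zero
    (convex_ball (0 : ℂ) 1).isPreconnected hf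
    (fun w hw => hd (UnitDisc.mk w (by simpa using hw)))
    (coe_mem_ball z) (coe_mem_ball 0)
  rw [ext_coe, ext_coe, h.1] at hc
  exact hc

/-- The norm of `B^v`. -/
def blochNorm (v : Weight) : AddGroupNorm (Bloch v) where
  toFun f := (blochENorm v f).toReal
  map_zero' := by
    change (blochENorm v 0).toReal = 0
    simp [blochENorm_zero]
  add_le' f g := by
    change (blochENorm v (f.1 + g.1)).toReal ≤ _
    rw [← ENNReal.toReal_add f.2.2.ne g.2.2.ne]
    exact ENNReal.toReal_mono (ENNReal.add_lt_top.2 ⟨f.2.2, g.2.2⟩).ne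
      (blochENorm_add_le v f.2.1 g.2.1)
  neg' f := by
    change (blochENorm v (-f.1)).toReal = (blochENorm v f.1).toReal
    rw [← neg_one_smul ℂ f.1, blochENorm_smul v _ f.2.1]
    simp
  eq_zero_of_map_eq_zero' f hf := by
    have h0 := (ENNReal.toReal_eq_zero_iff _).1 hf
    exact Subtype.ext (eq_zero_of_blochENorm v f.2.1 (h0.resolve_right f.2.2.ne))

instance (v : Weight) : NormedAddCommGroup (Bloch v) := (blochNorm v).toNormedAddCommGroup

instance (v : Weight) : NormedSpace ℂ (Bloch v) where
  norm_smul_le c f := by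
    change (blochENorm v (c • f.1)).toReal ≤ ‖c‖ * (blochENorm v f.1).toReal
    rw [blochENorm_smul v c f.2.1]
    simp

lemma Bloch.norm_def {v : Weight} (f : Bloch v) : ‖f‖ = (blochENorm v f).toReal := rfl

lemma one_lt_two_div (z : 𝔻) : 1 < 2 / (1 - ‖(z : ℂ)‖) := by
  have h := z.norm_lt_one
  have h0 := norm_nonneg (z : ℂ)
  rw [lt_div_iff₀ (by linarith)]
  linarith

lemma four_le_div (z : 𝔻) : 4 ≤ 4 / (1 - ‖(z : ℂ)‖ ^ 2) := by
  have h := z.sq_norm_lt_one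
  have h0 := sq_nonneg ‖(z : ℂ)‖
  rw [le_div_iff₀ (by linarith)]
  linarith

lemma one_lt_log_four : 1 < Real.log 4 := by
  rw [Real.lt_log_iff_exp_lt (by norm_num)]
  linarith [Real.exp_one_lt_d9]

lemma log_four_le (z : 𝔻) : Real.log 4 ≤ Real.log (4 / (1 - ‖(z : ℂ)‖ ^ 2)) :=
  Real.log_le_log (by norm_num) (four_le_div z)

lemma loglog_pos : 0 < Real.log (Real.log 4) := Real.log_pos one_lt_log_four

lemma loglog_le (z : 𝔻) :
    Real.log (Real.log 4) ≤ Real.log (Real.log (4 / (1 - ‖(z : ℂ)‖ ^ 2))) :=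
  Real.log_le_log (zero_lt_one.trans one_lt_log_four) (log_four_le z)

/-- `v_log(z) = (1 - |z|) log (2 / (1 - |z|))`. -/
def vLog : Weight where
  toFun z := (1 - ‖(z : ℂ)‖) * Real.log (2 / (1 - ‖(z : ℂ)‖))
  continuous := by
    have hc : Continuous fun z : 𝔻 => 1 - ‖(z : ℂ)‖ := by fun_prop
    have h1 : ∀ z : 𝔻, 1 - ‖(z : ℂ)‖ ≠ 0 := fun z => by linarith [z.norm_lt_one]
    exact hc.mul ((continuous_const.div hc h1).log
      fun z => (zero_lt_one.trans (one_lt_two_div z)).ne')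
  bounded := ⟨2, fun z => by
    have h : 0 < 1 - ‖(z : ℂ)‖ := by linarith [z.norm_lt_one]
    have h2 := Real.log_le_self (zero_lt_one.trans (one_lt_two_div z)).le
    calc (1 - ‖(z : ℂ)‖) * Real.log (2 / (1 - ‖(z : ℂ)‖))
        ≤ (1 - ‖(z : ℂ)‖) * (2 / (1 - ‖(z : ℂ)‖)) := by gcongr
      _ = 2 := by field_simp⟩
  pos z := mul_pos (by linarith [z.norm_lt_one]) (Real.log_pos (one_lt_two_div z))

/-- `w_log(z) = [log log (4 / (1 - |z|²))]⁻¹`. -/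
def wLog : Weight where
  toFun z := (Real.log (Real.log (4 / (1 - ‖(z : ℂ)‖ ^ 2))))⁻¹
  continuous := by
    have hc : Continuous fun z : 𝔻 => 1 - ‖(z : ℂ)‖ ^ 2 := by fun_prop
    have h1 : ∀ z : 𝔻, 1 - ‖(z : ℂ)‖ ^ 2 ≠ 0 := fun z => by linarith [z.sq_norm_lt_one]
    exact (((continuous_const.div hc h1).log
      (fun z => by linarith [four_le_div z] : ∀ z : 𝔻, 4 / (1 - ‖(z : ℂ)‖ ^ 2) ≠ 0)).log
      (fun z => (zero_lt_one.trans (one_lt_log_four.trans_le (log_four_le z))).ne')).inv₀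
      (fun z => (loglog_pos.trans_le (loglog_le z)).ne')
  bounded := ⟨(Real.log (Real.log 4))⁻¹, fun z => inv_anti₀ loglog_pos (loglog_le z)⟩
  pos z := inv_pos.2 (loglog_pos.trans_le (loglog_le z))

/-- The essential norm: the distance of `T` to the compact operators. -/
def essNorm {X Y : Type*} [NormedAddCommGroup X] [NormedSpace ℂ X] [NormedAddCommGroup Y]
    [NormedSpace ℂ Y] (T : X →L[ℂ] Y) : ℝ≥0∞ :=
  ⨅ (K : X →L[ℂ] Y) (_ : IsCompactOperator K), ‖T - K‖ₑ

/-- The monomial `g_n(z) = z ^ n`. -/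
def g (n : ℕ) : 𝔻 → ℂ := fun z => (z : ℂ) ^ n

/-- The power `φ^n` (pointwise), as a complex-valued function on the disc. -/
def powφ (φ : 𝔻 → 𝔻) (n : ℕ) : 𝔻 → ℂ := fun z => (φ z : ℂ) ^ n

/-- `(n+1) ‖J_u(φ^n)‖_{B^{v_log}} / ‖g_{n+1}‖_{B^{w_log}}`. -/
def ratioJ (u : 𝔻 → ℂ) (φ : 𝔻 → 𝔻) (n : ℕ) : ℝ≥0∞ :=
  ((n : ℝ≥0∞) + 1) * blochENorm vLog (opJ u (powφ φ n)) / blochENorm wLog (g (n + 1))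

/-- `‖I_u(φ^n)‖_{B^{v_log}} / ‖g_n‖_{B^{v_log}}`. -/
def ratioI (u : 𝔻 → ℂ) (φ : 𝔻 → 𝔻) (n : ℕ) : ℝ≥0∞ :=
  blochENorm vLog (opI u (powφ φ n)) / blochENorm vLog (g n)

end LogBloch

end

/-!
The derivative of `W f = u · (f ∘ φ)` splits as `u' · (f ∘ φ) + u φ' · (f' ∘ φ)`. With the symbols
`J = v_log |u'|` and `I = v_log |u φ'|`, both sides of the theorem are compared with the boundary
sizes `limsup J / w_log(φ)` and `limsup I / v_log(φ)` as `|φ(z)| → 1`, where the two denominators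
are the reciprocal growth of `f` and of `f'` for `f` in the logarithmic Bloch space. An upper bound
`c` for such a boundary size is encoded as `BoundaryLE Q φ h c`.

* The quotients of the theorem are, up to a shift of the index, the moment quotients
  `sup_z Q(z) |φ(z)|^n / sup_z h(|z|) |z|^n`. For weights `h` that are almost decreasing and fall
  off at most linearly (`IsSlow`), the moment of order `n ≈ 1 / (1 - r)` sees the points with
  `|φ(z)| ≈ r`, so the limit superior of the quotients is comparable to the boundary size
  (`BoundaryLE.limsup_momentRatio_le`, `IsSlow.boundaryLE_of_limsup_lt`).
* Upper estimate of the essential norm (`essNorm_le_of_boundaryLE`): Taylor polynomials of dilations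
  give finite rank operators `T` for which `f - T f` is small on a given compact set and of the
  natural growth everywhere (`exists_isCompactOperator_close`); then `W T` is compact and `W - W T`
  only feels the symbols near the boundary.
* Lower estimate (`boundaryLE_of_essNorm_lt`): with `F = log log (8 / (1 - ā w))` the functions
  `2 F - F² / F(a)` and `F² / F(a) - F` are bounded in the space uniformly in `a`; at `a` the first
  has derivative `0` and a value of maximal order, the second has value `0` and a derivative of
  maximal order. No weak convergence is needed: if `K` is compact, then `K` is small on suitable
  differences of test functions, while `W` maps each single test function to a function whose
  weighted derivative vanishes as `|φ| → 1` (`exists_annulus_weighted_cderiv_le`).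

The characterization of compactness follows, since the compact operators are closed in the operator
norm, the logarithmic Bloch space being complete.
-/

noncomputable section

namespace LogBloch

/-! ### Holomorphic functions on the disc -/

lemma ext_eqOn (F : ℂ → ℂ) : Set.EqOn (ext fun z : 𝔻 => F z) F (Metric.ball 0 1) := by
  intro w hw
  exact ext_coe (fun z : 𝔻 => F z) (UnitDisc.mk w (by simpa using hw))

lemma isHolo_of_differentiableOn {F : ℂ → ℂ} (hF : DifferentiableOn ℂ F (Metric.ball 0 1)) :
    IsHolo fun z => F z :=
  hF.congr (ext_eqOn F)

lemma cderiv_coe (F : ℂ → ℂ) (z : 𝔻) : cderiv (fun z => F z) z = deriv F z :=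
  ((ext_eqOn F).eventuallyEq_of_mem (Metric.isOpen_ball.mem_nhds (coe_mem_ball z))).deriv_eq

lemma eq_ext_coe (f : 𝔻 → ℂ) : f = fun z : 𝔻 => ext f z := by
  funext z
  exact (ext_coe f z).symm

lemma IsHolo.mul {f g : 𝔻 → ℂ} (hf : IsHolo f) (hg : IsHolo g) :
    IsHolo fun z => f z * g z := by
  rw [eq_ext_coe f, eq_ext_coe g]
  exact isHolo_of_differentiableOn (F := fun w => ext f w * ext g w) (DifferentiableOn.mul hf hg)

lemma cderiv_mul {f g : 𝔻 → ℂ} (hf : IsHolo f) (hg : IsHolo g) (z : 𝔻) :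
    cderiv (fun z => f z * g z) z = cderiv f z * g z + f z * cderiv g z := by
  have h := cderiv_coe (fun w => ext f w * ext g w) z
  simp only [ext_coe] at h
  rw [h, deriv_fun_mul (hf.differentiableAt z) (hg.differentiableAt z)]
  simp only [ext_coe, cderiv]

lemma ext_mapsTo (φ : 𝔻 → 𝔻) :
    Set.MapsTo (ext fun z => (φ z : ℂ)) (Metric.ball 0 1) (Metric.ball 0 1) := by
  intro w hw
  have := ext_coe (fun z => (φ z : ℂ)) (UnitDisc.mk w (by simpa using hw))
  rw [UnitDisc.coe_mk] at this
  rw [this]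
  exact coe_mem_ball _

lemma IsHolo.comp {f : 𝔻 → ℂ} {φ : 𝔻 → 𝔻} (hf : IsHolo f) (hφ : IsHolo fun z => (φ z : ℂ)) :
    IsHolo fun z => f (φ z) := by
  have h := isHolo_of_differentiableOn (DifferentiableOn.comp hf hφ (ext_mapsTo φ))
  simpa only [Function.comp_apply, ext_coe] using h

lemma cderiv_comp {f : 𝔻 → ℂ} {φ : 𝔻 → 𝔻} (hf : IsHolo f) (hφ : IsHolo fun z => (φ z : ℂ))
    (z : 𝔻) : cderiv (fun z => f (φ z)) z = cderiv f (φ z) * cderiv (fun z => (φ z : ℂ)) z := by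
  have h := cderiv_coe (fun w => ext f (ext (fun z => (φ z : ℂ)) w)) z
  simp only [ext_coe] at h
  have h1 : ext (fun z => (φ z : ℂ)) z = φ z := ext_coe _ z
  have h2 : DifferentiableAt ℂ (ext f) (ext (fun z => (φ z : ℂ)) z) := by
    rw [h1]; exact hf.differentiableAt _
  rw [h]
  have := deriv_comp (z : ℂ) h2 (hφ.differentiableAt z)
  rw [Function.comp_def] at this
  rw [this, h1]
  rfl

lemma IsHolo.cderiv {f : 𝔻 → ℂ} (hf : IsHolo f) : IsHolo (cderiv f) :=
  isHolo_of_differentiableOn (DifferentiableOn.deriv hf Metric.isOpen_ball)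

lemma isHolo_g (n : ℕ) : IsHolo (g n) :=
  isHolo_of_differentiableOn (F := fun w => w ^ n) (by fun_prop)

lemma cderiv_g (n : ℕ) (z : 𝔻) : LogBloch.cderiv (g n) z = n * (z : ℂ) ^ (n - 1) := by
  unfold g
  rw [cderiv_coe (fun w => w ^ n)]; simp

lemma isHolo_powφ {φ : 𝔻 → 𝔻} (hφ : IsHolo fun z => (φ z : ℂ)) (n : ℕ) : IsHolo (powφ φ n) :=
  (isHolo_g n).comp hφ

lemma cderiv_powφ {φ : 𝔻 → 𝔻} (hφ : IsHolo fun z => (φ z : ℂ)) (n : ℕ) (z : 𝔻) :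
    LogBloch.cderiv (powφ φ n) z
      = n * (φ z : ℂ) ^ (n - 1) * LogBloch.cderiv (fun z => (φ z : ℂ)) z := by
  rw [← cderiv_g]
  exact cderiv_comp (isHolo_g n) hφ z

/-- A holomorphic function on the disc is the derivative of its integral from `0`. -/
lemma cderiv_prim {F : 𝔻 → ℂ} (hF : IsHolo F) (z : 𝔻) : LogBloch.cderiv (prim F) z = F z := by
  obtain ⟨G, hG⟩ := DifferentiableOn.isExactOn_ball hF
  have key : ∀ z : 𝔻, prim F z = G z - G 0 := by
    intro z
    have hmem : ∀ t ∈ Set.uIcc (0 : ℝ) 1, (t : ℂ) * z ∈ Metric.ball (0 : ℂ) 1 := by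
      intro t ht
      rw [Set.uIcc_of_le zero_le_one] at ht
      have hz := z.norm_lt_one
      have := norm_nonneg (z : ℂ)
      simp only [mem_ball_zero_iff, norm_mul, norm_real, Real.norm_eq_abs, abs_of_nonneg ht.1]
      nlinarith [ht.2]
    have hd : ∀ t ∈ Set.uIcc (0 : ℝ) 1,
        HasDerivAt (fun t : ℝ => G ((t : ℂ) * z)) (ext F ((t : ℂ) * z) * z) t := by
      intro t ht
      have h1 : HasDerivAt (fun t : ℝ => (t : ℂ) * (z : ℂ)) (z : ℂ) t := by
        simpa using (HasDerivAt.ofReal_comp (hasDerivAt_id t)).mul_const (z : ℂ)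
      exact (hG _ (hmem t ht)).comp t h1
    have hc : ContinuousOn (fun t : ℝ => ext F ((t : ℂ) * z) * z) (Set.uIcc 0 1) := by
      refine ContinuousOn.mul ?_ continuousOn_const
      exact (DifferentiableOn.continuousOn hF).comp (by fun_prop) hmem
    have := intervalIntegral.integral_eq_sub_of_hasDerivAt hd hc.intervalIntegrable
    simpa [prim] using this
  have h2 : prim F = fun z : 𝔻 => G z - G 0 := funext key
  rw [h2, cderiv_coe (fun w => G w - G 0), ← ext_coe F z]
  exact ((hG _ (coe_mem_ball z)).sub_const _).deriv

lemma prim_apply_zero (F : 𝔻 → ℂ) : prim F 0 = 0 := by simp [prim]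

/-! ### The norm of the Bloch-type spaces -/

lemma blochENorm_le {v : Weight} {f : 𝔻 → ℂ} {a b : ℝ} (h0 : ‖f 0‖ ≤ a)
    (h : ∀ z, v.toFun z * ‖cderiv f z‖ ≤ b) : blochENorm v f ≤ ENNReal.ofReal (a + b) := by
  have hb : 0 ≤ b := (mul_nonneg (v.pos 0).le (norm_nonneg _)).trans (h 0)
  rw [ENNReal.ofReal_add ((norm_nonneg _).trans h0) hb]
  unfold blochENorm
  gcongr
  · rw [← ofReal_norm]
    exact ENNReal.ofReal_le_ofReal h0
  · refine iSup_le fun z => ?_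
    rw [← ofReal_norm, ← ENNReal.ofReal_mul (v.pos z).le]
    exact ENNReal.ofReal_le_ofReal (h z)

/-- A holomorphic function whose weighted derivative is bounded, as an element of `B^v`. -/
def Bloch.mk {v : Weight} (f : 𝔻 → ℂ) (hf : IsHolo f)
    (h : ∃ b : ℝ, ∀ z, v.toFun z * ‖cderiv f z‖ ≤ b) : Bloch v :=
  ⟨f, hf, by
    obtain ⟨b, hb⟩ := h
    exact (blochENorm_le le_rfl hb).trans_lt ENNReal.ofReal_lt_top⟩

lemma Bloch.isHolo {v : Weight} (f : Bloch v) : IsHolo (f : 𝔻 → ℂ) := f.2.1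

lemma Bloch.norm_le {v : Weight} (f : Bloch v) {a b : ℝ} (h0 : ‖(f : 𝔻 → ℂ) 0‖ ≤ a)
    (h : ∀ z, v.toFun z * ‖LogBloch.cderiv f z‖ ≤ b) : ‖f‖ ≤ a + b := by
  have hb : 0 ≤ b := (mul_nonneg (v.pos 0).le (norm_nonneg _)).trans (h 0)
  exact ENNReal.toReal_le_of_le_ofReal (add_nonneg ((norm_nonneg _).trans h0) hb)
    (blochENorm_le h0 h)

lemma Bloch.norm_apply_zero_le {v : Weight} (f : Bloch v) : ‖(f : 𝔻 → ℂ) 0‖ ≤ ‖f‖ := by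
  rw [Bloch.norm_def, ← toReal_enorm]
  exact ENNReal.toReal_mono f.2.2.ne le_self_add

lemma Bloch.mul_norm_cderiv_le {v : Weight} (f : Bloch v) (z : 𝔻) :
    v.toFun z * ‖LogBloch.cderiv f z‖ ≤ ‖f‖ := by
  have h : ENNReal.ofReal (v.toFun z) * ‖LogBloch.cderiv f z‖ₑ ≤ blochENorm v f :=
    (le_iSup (fun z : 𝔻 => ENNReal.ofReal (v.toFun z) * ‖LogBloch.cderiv f z‖ₑ) z).trans
      le_add_self
  have := ENNReal.toReal_mono f.2.2.ne h
  rwa [ENNReal.toReal_mul, ENNReal.toReal_ofReal (v.pos z).le, toReal_enorm] at this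

lemma Bloch.sub_apply {v : Weight} (f h : Bloch v) (z : 𝔻) :
    ((f - h : Bloch v) : 𝔻 → ℂ) z = (f : 𝔻 → ℂ) z - (h : 𝔻 → ℂ) z := rfl

lemma Bloch.cderiv_sub {v : Weight} (f h : Bloch v) (z : 𝔻) :
    LogBloch.cderiv ((f - h : Bloch v) : 𝔻 → ℂ) z
      = LogBloch.cderiv f z - LogBloch.cderiv h z := by
  have h1 : ((f - h : Bloch v) : 𝔻 → ℂ) = (f : 𝔻 → ℂ) + (-1 : ℂ) • (h : 𝔻 → ℂ) := by
    funext z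
    rw [Bloch.sub_apply, Pi.add_apply, Pi.smul_apply, smul_eq_mul]; ring
  rw [h1, cderiv_add f.isHolo (h.isHolo.smul _), cderiv_smul _ h.isHolo]; ring

lemma Bloch.ext_sub {v : Weight} (f h : Bloch v) :
    LogBloch.ext ((f - h : Bloch v) : 𝔻 → ℂ) = LogBloch.ext f - LogBloch.ext h := by
  have h1 : ((f - h : Bloch v) : 𝔻 → ℂ) = (f : 𝔻 → ℂ) + (-1 : ℂ) • (h : 𝔻 → ℂ) := by
    funext z
    rw [Bloch.sub_apply, Pi.add_apply, Pi.smul_apply, smul_eq_mul]; ring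
  rw [h1, ext_add, ext_smul]; simp [sub_eq_add_neg]

/-! ### The two radial weights -/

/-- The radial profile of `v_log`, a function of `r = |z| ∈ [0, 1)`. -/
def vRad (r : ℝ) : ℝ := (1 - r) * Real.log (2 / (1 - r))

/-- The radial profile of `w_log`, a function of `r = |z| ∈ [0, 1)`. -/
def wRad (r : ℝ) : ℝ := (Real.log (Real.log (4 / (1 - r ^ 2))))⁻¹

lemma vLog_apply (z : 𝔻) : vLog.toFun z = vRad ‖(z : ℂ)‖ := rfl

/-- Radial functions `h > 0` on `[0, 1)` which are almost decreasing and fall off at most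
linearly at the boundary, up to the factor `C`. -/
structure IsSlow (h : ℝ → ℝ) (C : ℝ) : Prop where
  pos : ∀ r, 0 ≤ r → r < 1 → 0 < h r
  le : ∀ r s, 0 ≤ r → r < 1 → 0 ≤ s → s < 1 → h s ≤ C * max 1 ((1 - s) / (1 - r)) * h r

lemma half_le_log_two : 1 / 2 ≤ Real.log 2 := by linarith [Real.log_two_gt_d9]

lemma vRad_pos {r : ℝ} (h0 : 0 ≤ r) (h1 : r < 1) : 0 < vRad r := by
  have h : 0 < 1 - r := by linarith
  refine mul_pos h (Real.log_pos ?_)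
  rw [lt_div_iff₀ h]; linarith

lemma log_two_le_log_two_div {r : ℝ} (h0 : 0 ≤ r) (h1 : r < 1) :
    Real.log 2 ≤ Real.log (2 / (1 - r)) := by
  have h : 0 < 1 - r := by linarith
  refine Real.log_le_log (by norm_num) ?_
  rw [le_div_iff₀ h]; linarith

/-- `log (a / x) ≤ log (a / y) + (y / x - 1)`. -/
lemma log_div_le_log_div_add {a x y : ℝ} (ha : 0 < a) (hx : 0 < x) (hy : 0 < y) :
    Real.log (a / x) ≤ Real.log (a / y) + (y / x - 1) := by
  have h1 : a / x = a / y * (y / x) := by field_simp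
  rw [h1, Real.log_mul (by positivity) (by positivity)]
  linarith [Real.log_le_sub_one_of_pos (div_pos hy hx)]

lemma vRad_le_two_mul {r s : ℝ} (hr : 0 ≤ r) (hs : s < 1) (hrs : r ≤ s) :
    vRad s ≤ 2 * vRad r := by
  have hr' : 0 < 1 - r := by linarith
  have hs' : 0 < 1 - s := by linarith
  have h1 := mul_le_mul_of_nonneg_left
    (log_div_le_log_div_add (a := 2) two_pos hs' hr') hs'.le
  have h2 : (1 - s) * ((1 - r) / (1 - s) - 1) = s - r := by field_simp; ring
  have hl := half_le_log_two.trans (log_two_le_log_two_div hr (hrs.trans_lt hs))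
  unfold vRad
  have h3 := mul_nonneg (sub_nonneg.2 hrs) (sub_nonneg.2 hl)
  have h4 := mul_nonneg hs'.le (half_pos one_pos |>.le.trans hl)
  nlinarith

lemma isSlow_vRad : IsSlow vRad 2 where
  pos _ := vRad_pos
  le r s hr hr1 hs hs1 := by
    have hr' : 0 < 1 - r := by linarith
    have hs' : 0 < 1 - s := by linarith
    have hv := vRad_pos hr hr1
    rcases le_total r s with h | h
    · refine (vRad_le_two_mul hr hs1 h).trans ?_
      have := le_max_left 1 ((1 - s) / (1 - r))
      nlinarith
    · have h1 : vRad s ≤ (1 - s) / (1 - r) * vRad r := by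
        unfold vRad
        have : (1 - s) / (1 - r) * ((1 - r) * Real.log (2 / (1 - r)))
            = (1 - s) * Real.log (2 / (1 - r)) := by field_simp
        rw [this]
        refine mul_le_mul_of_nonneg_left (Real.log_le_log (by positivity) ?_) hs'.le
        gcongr
      have h2 := le_max_right 1 ((1 - s) / (1 - r))
      have h3 := le_max_left 1 ((1 - s) / (1 - r))
      nlinarith

lemma four_le_four_div {r : ℝ} (h0 : 0 ≤ r) (h1 : r < 1) : 4 ≤ 4 / (1 - r ^ 2) := by
  rw [le_div_iff₀ (by nlinarith)]; nlinarith

lemma one_lt_log_div {r : ℝ} (h0 : 0 ≤ r) (h1 : r < 1) : 1 < Real.log (4 / (1 - r ^ 2)) :=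
  one_lt_log_four.trans_le (Real.log_le_log (by norm_num) (four_le_four_div h0 h1))

lemma loglog_four_le {r : ℝ} (h0 : 0 ≤ r) (h1 : r < 1) :
    Real.log (Real.log 4) ≤ Real.log (Real.log (4 / (1 - r ^ 2))) :=
  Real.log_le_log (zero_lt_one.trans one_lt_log_four)
    (Real.log_le_log (by norm_num) (four_le_four_div h0 h1))

lemma loglog_four_le_one : Real.log (Real.log 4) ≤ 1 := by
  have h4 : Real.log 4 = 2 * Real.log 2 := by
    rw [show (4 : ℝ) = 2 ^ 2 by norm_num, Real.log_pow]; norm_num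
  have := Real.log_le_sub_one_of_pos (zero_lt_one.trans one_lt_log_four)
  have := Real.log_two_lt_d9
  linarith

lemma wRad_pos {r : ℝ} (h0 : 0 ≤ r) (h1 : r < 1) : 0 < wRad r :=
  inv_pos.2 (loglog_pos.trans_le (loglog_four_le h0 h1))

lemma wRad_anti {r s : ℝ} (hr : 0 ≤ r) (hs : s < 1) (h : r ≤ s) : wRad s ≤ wRad r := by
  have hr1 := h.trans_lt hs
  refine inv_anti₀ (loglog_pos.trans_le (loglog_four_le hr hr1))
    (Real.log_le_log (by linarith [one_lt_log_div hr hr1]) (Real.log_le_log ?_ ?_))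
  · linarith [four_le_four_div hr hr1]
  · have : 0 < 1 - s ^ 2 := by nlinarith
    gcongr

lemma isSlow_wRad : IsSlow wRad (Real.log (Real.log 4))⁻¹ where
  pos _ := wRad_pos
  le r s hr hr1 hs hs1 := by
    have hr' : 0 < 1 - r := by linarith
    have hs' : 0 < 1 - s := by linarith
    have hw := wRad_pos hr hr1
    have hc := loglog_pos
    have hc1 : 1 ≤ (Real.log (Real.log 4))⁻¹ := (one_le_inv₀ hc).2 loglog_four_le_one
    have h3 := le_max_left 1 ((1 - s) / (1 - r))
    rcases le_total r s with h | h
    · refine (wRad_anti hr hs1 h).trans ?_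
      have : 1 ≤ (Real.log (Real.log 4))⁻¹ * max 1 ((1 - s) / (1 - r)) := by nlinarith
      nlinarith
    · refine le_trans ?_ (mul_le_mul_of_nonneg_right
        (mul_le_mul_of_nonneg_left (le_max_right 1 ((1 - s) / (1 - r))) (by positivity)) hw.le)
      set c := Real.log (Real.log 4)
      have hp : 0 < 1 - s ^ 2 := by nlinarith
      have hq : 0 < 1 - r ^ 2 := by nlinarith
      set P := Real.log (4 / (1 - s ^ 2)) with hP
      set Q := Real.log (4 / (1 - r ^ 2)) with hQ
      have hP1 : 1 < P := one_lt_log_div hs hs1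
      have hQ1 : 1 < Q := one_lt_log_div hr hr1
      have hPc : c ≤ Real.log P := loglog_four_le hs hs1
      have hQc : c ≤ Real.log Q := loglog_four_le hr hr1
      -- `t` bounds the quotient `(1 - s ^ 2) / (1 - r ^ 2)`
      set t := (1 - s) / (1 - r) with ht
      have ht1 : 1 ≤ t := by rw [ht, le_div_iff₀ hr']; linarith
      have htq : (1 - s ^ 2) / (1 - r ^ 2) ≤ t := by
        rw [ht, div_le_div_iff₀ hq hr']
        nlinarith [mul_nonneg hs'.le hr'.le, mul_nonneg (mul_nonneg hs'.le hr'.le) (sub_nonneg.2 h)]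
      have hQP : Q ≤ P + (t - 1) := by
        have := log_div_le_log_div_add (a := 4) (by norm_num) hq hp
        linarith
      have hlog : Real.log Q ≤ Real.log P + (t - 1) := by
        have h1 : Real.log Q ≤ Real.log P + (Q / P - 1) := by
          have := Real.log_le_sub_one_of_pos (div_pos (zero_lt_one.trans hQ1)
            (zero_lt_one.trans hP1))
          rw [Real.log_div (by positivity) (by positivity)] at this
          linarith
        have h2 : Q / P ≤ t := by
          rw [div_le_iff₀ (by linarith)]; nlinarith
        linarith
      -- absorb the additive error, using `log P ≥ c` and `c ≤ 1`
      have hfin : c * Real.log Q ≤ t * Real.log P := by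
        have : c ≤ 1 := loglog_four_le_one
        nlinarith [mul_nonneg (sub_nonneg.2 ht1) (sub_nonneg.2 hPc),
          mul_nonneg (sub_nonneg.2 this) (hc.le.trans hPc),
          mul_nonneg (mul_nonneg (sub_nonneg.2 this) hc.le) (sub_nonneg.2 ht1),
          mul_nonneg hc.le (sub_nonneg.2 hlog)]
      change (Real.log P)⁻¹ ≤ c⁻¹ * t * (Real.log Q)⁻¹
      have hPp : 0 < Real.log P := hc.trans_le hPc
      have hQp : 0 < Real.log Q := hc.trans_le hQc
      rw [inv_le_iff_one_le_mul₀ hPp]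
      have : c⁻¹ * t * (Real.log Q)⁻¹ * Real.log P = (t * Real.log P) / (c * Real.log Q) := by
        field_simp
      rw [this, one_le_div (by positivity)]
      exact hfin

lemma vRad_le_two {r : ℝ} (h0 : 0 ≤ r) (h1 : r < 1) : vRad r ≤ 2 := by
  have := vRad_le_two_mul le_rfl h1 h0
  have h2 : vRad 0 = Real.log 2 := by simp [vRad]
  have := Real.log_two_lt_d9
  linarith

lemma wRad_le {r : ℝ} (h0 : 0 ≤ r) (h1 : r < 1) : wRad r ≤ (Real.log (Real.log 4))⁻¹ :=
  inv_anti₀ loglog_pos (loglog_four_le h0 h1)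

lemma tendsto_four_div : Tendsto (fun r : ℝ => 4 / (1 - r ^ 2)) (𝓝[<] 1) atTop := by
  have h : Tendsto (fun r : ℝ => 1 - r ^ 2) (𝓝[<] 1) (𝓝[>] 0) := by
    refine tendsto_nhdsWithin_iff.2 ⟨?_, ?_⟩
    · have : ContinuousAt (fun r : ℝ => 1 - r ^ 2) 1 := by fun_prop
      have := this.tendsto
      norm_num at this
      exact this.mono_left nhdsWithin_le_nhds
    · filter_upwards [Ioo_mem_nhdsLT (show (0 : ℝ) < 1 by norm_num)] with r hr
      simp only [Set.mem_Ioi]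
      nlinarith [hr.1, hr.2]
  simpa [div_eq_mul_inv] using
    (tendsto_inv_nhdsGT_zero.comp h).const_mul_atTop (show (0 : ℝ) < 4 by norm_num)

lemma tendsto_wRad : Tendsto wRad (𝓝[<] 1) (𝓝 0) :=
  tendsto_inv_atTop_zero.comp
    (Real.tendsto_log_atTop.comp (Real.tendsto_log_atTop.comp tendsto_four_div))

lemma tendsto_vRad : Tendsto vRad (𝓝[<] 1) (𝓝 0) := by
  have h : Tendsto (fun r : ℝ => (1 - r) / 2) (𝓝[<] 1) (𝓝 0) := by
    have : ContinuousAt (fun r : ℝ => (1 - r) / 2) 1 := by fun_prop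
    have := this.tendsto
    norm_num at this
    exact this.mono_left nhdsWithin_le_nhds
  have h2 := (Real.continuous_mul_log.tendsto 0).comp h
  have h3 := h2.const_mul (-2)
  simp only [zero_mul, mul_zero] at h3
  refine h3.congr fun r => ?_
  simp only [Function.comp_apply, vRad]
  rw [← inv_div (1 - r) 2, Real.log_inv]; ring

/-- A radial weight that is small near `r = 1` is small on an annulus `ρ < r < 1`. -/
lemma exists_annulus_lt {h : ℝ → ℝ} (hh : Tendsto h (𝓝[<] 1) (𝓝 0)) {ε : ℝ} (hε : 0 < ε) :
    ∃ ρ, 0 < ρ ∧ ρ < 1 ∧ ∀ r, ρ < r → r < 1 → h r < ε := by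
  have := hh.eventually (gt_mem_nhds hε)
  obtain ⟨l, hl, hl'⟩ := (mem_nhdsLT_iff_exists_Ioo_subset' (show (0 : ℝ) < 1 by norm_num)).1 this
  refine ⟨max l (1 / 2), by positivity, max_lt hl (by norm_num), fun r hr hr1 => ?_⟩
  exact hl' ⟨(le_max_left _ _).trans_lt hr, hr1⟩

/-! ### Power moments and boundary behaviour -/

/-- The quotient `sup_z Q(z) |φ(z)|^n / sup_z h(|z|) |z|^n`. -/
def momentRatio (Q : 𝔻 → ℝ) (φ : 𝔻 → 𝔻) (h : ℝ → ℝ) (n : ℕ) : ℝ≥0∞ :=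
  (⨆ z, ENNReal.ofReal (Q z * ‖(φ z : ℂ)‖ ^ n)) /
    ⨆ z : 𝔻, ENNReal.ofReal (h ‖(z : ℂ)‖ * ‖(z : ℂ)‖ ^ n)

/-- `Q(z) ≤ c h(|φ(z)|)` as soon as `φ(z)` is close enough to the unit circle. -/
def BoundaryLE (Q : 𝔻 → ℝ) (φ : 𝔻 → 𝔻) (h : ℝ → ℝ) (c : ℝ) : Prop :=
  ∃ ρ, 0 < ρ ∧ ρ < 1 ∧ ∀ z, ρ < ‖(φ z : ℂ)‖ → Q z ≤ c * h ‖(φ z : ℂ)‖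

lemma exists_norm_eq {s : ℝ} (h0 : 0 ≤ s) (h1 : s < 1) : ∃ z : 𝔻, ‖(z : ℂ)‖ = s :=
  ⟨UnitDisc.mk s (by simpa [abs_of_nonneg h0] using h1), by simp [abs_of_nonneg h0]⟩

/-- The part of the supremum over `|φ| ≤ ρ` is `O(ρ ^ n)`, which is negligible against
`sup_z h(|z|) |z| ^ n`. -/
lemma BoundaryLE.limsup_momentRatio_le {Q : 𝔻 → ℝ} {φ : 𝔻 → 𝔻} {h : ℝ → ℝ} {c M : ℝ}
    (hh : ∀ r, 0 ≤ r → r < 1 → 0 < h r) (hM : ∀ z, Q z ≤ M) (hc : 0 ≤ c)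
    (hQ : BoundaryLE Q φ h c) : limsup (momentRatio Q φ h) atTop ≤ ENNReal.ofReal c := by
  obtain ⟨ρ, hρ0, hρ1, hρ⟩ := hQ
  refine ENNReal.le_of_forall_pos_le_add fun ε hε _ => ?_
  rw [← ENNReal.ofReal_coe_nnreal, ← ENNReal.ofReal_add hc ε.coe_nonneg]
  have hε' : (0 : ℝ) < ε := hε
  obtain ⟨s, hρs, hs1⟩ := exists_between hρ1
  have hs0 : 0 < s := hρ0.trans hρs
  obtain ⟨zs, hzs⟩ := exists_norm_eq hs0.le hs1
  have hlim : Tendsto (fun n : ℕ => |M| * (ρ / s) ^ n) atTop (𝓝 0) := by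
    simpa using (tendsto_pow_atTop_nhds_zero_of_lt_one (by positivity)
      ((div_lt_one hs0).2 hρs)).const_mul |M|
  refine limsup_le_of_le (by isBoundedDefault) ?_
  filter_upwards [hlim.eventually (gt_mem_nhds (mul_pos hε' (hh s hs0.le hs1)))] with n hn
  refine ENNReal.div_le_of_le_mul (iSup_le fun z => ?_)
  rcases lt_or_ge ρ ‖(φ z : ℂ)‖ with hz | hz
  · refine le_trans ?_ (mul_le_mul_right (le_iSup
      (fun z : 𝔻 => ENNReal.ofReal (h ‖(z : ℂ)‖ * ‖(z : ℂ)‖ ^ n)) (φ z)) _)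
    rw [← ENNReal.ofReal_mul (by positivity)]
    refine ENNReal.ofReal_le_ofReal ?_
    rw [← mul_assoc]
    have := hh _ (norm_nonneg _) (φ z).norm_lt_one
    gcongr
    exact (hρ z hz).trans (by gcongr; linarith)
  · refine le_trans ?_ (mul_le_mul_right (le_iSup
      (fun z : 𝔻 => ENNReal.ofReal (h ‖(z : ℂ)‖ * ‖(z : ℂ)‖ ^ n)) zs) _)
    rw [← ENNReal.ofReal_mul (by positivity)]
    refine ENNReal.ofReal_le_ofReal ?_
    rw [hzs]
    calc Q z * ‖(φ z : ℂ)‖ ^ n ≤ |M| * ρ ^ n := by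
          gcongr
          exact (hM z).trans (le_abs_self M)
      _ = |M| * (ρ / s) ^ n * s ^ n := by rw [div_pow]; field_simp
      _ ≤ (ε * h s) * s ^ n := by gcongr
      _ ≤ (c + ε) * (h s * s ^ n) := by
          have := hh s hs0.le hs1
          have : 0 ≤ c * (h s * s ^ n) := by positivity
          nlinarith

lemma one_add_mul_mul_pow_le_one {s : ℝ} (h0 : 0 ≤ s) (h1 : s ≤ 1) (n : ℕ) :
    (1 + n * (1 - s)) * s ^ n ≤ 1 := by
  have h2 := one_add_mul_le_pow (a := 1 - s) (by linarith) n
  calc (1 + n * (1 - s)) * s ^ n ≤ (1 + (1 - s)) ^ n * s ^ n := by gcongr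
    _ = ((1 + (1 - s)) * s) ^ n := (mul_pow _ _ _).symm
    _ ≤ 1 := pow_le_one₀ (by nlinarith) (by nlinarith)

/-- The moment `sup_s h(s) s ^ n` is comparable to `h(r)` once `n ≥ 1 / (1 - r)`. -/
lemma IsSlow.mul_pow_le {h : ℝ → ℝ} {C : ℝ} (hh : IsSlow h C) {r s : ℝ} (hr : 0 ≤ r) (hr1 : r < 1)
    (hs : 0 ≤ s) (hs1 : s < 1) {n : ℕ} (hn : 1 / (1 - r) ≤ n) : h s * s ^ n ≤ C * h r := by
  have hC : 0 ≤ C * h r := by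
    have h1 := hh.le r r hr hr1 hr hr1
    rw [div_self (by linarith), max_self, mul_one] at h1
    exact (hh.pos r hr hr1).le.trans h1
  have hr' : 0 < 1 - r := by linarith
  have hs' : 0 < 1 - s := by linarith
  have hmax : max 1 ((1 - s) / (1 - r)) ≤ 1 + n * (1 - s) := by
    refine max_le (by nlinarith [Nat.cast_nonneg (α := ℝ) n]) ?_
    rw [div_eq_mul_one_div]
    nlinarith
  calc h s * s ^ n ≤ C * max 1 ((1 - s) / (1 - r)) * h r * s ^ n := by
        gcongr; exact hh.le r s hr hr1 hs hs1
    _ = C * h r * (max 1 ((1 - s) / (1 - r)) * s ^ n) := by ring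
    _ ≤ C * h r * ((1 + n * (1 - s)) * s ^ n) := by gcongr
    _ ≤ C * h r * 1 := by gcongr; exact one_add_mul_mul_pow_le_one hs hs1.le n
    _ = C * h r := mul_one _

lemma one_le_exp_mul_pow {r : ℝ} (hr : 1 / 2 ≤ r) (hr1 : r < 1) :
    1 ≤ Real.exp 3 * r ^ ⌈1 / (1 - r)⌉₊ := by
  have hr0 : 0 < r := by linarith
  have hr' : 0 < 1 - r := by linarith
  have h1 : r⁻¹ ≤ Real.exp ((1 - r) / r) := by
    have := Real.add_one_le_exp ((1 - r) / r)
    have h2 : r⁻¹ = (1 - r) / r + 1 := by field_simp; ring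
    linarith
  have h2 : (⌈1 / (1 - r)⌉₊ : ℝ) * ((1 - r) / r) ≤ 3 := by
    have h3 := (Nat.ceil_lt_add_one (a := 1 / (1 - r)) (by positivity)).le
    calc (⌈1 / (1 - r)⌉₊ : ℝ) * ((1 - r) / r) ≤ (1 / (1 - r) + 1) * ((1 - r) / r) := by gcongr
      _ = (2 - r) / r := by field_simp; ring
      _ ≤ 3 := by rw [div_le_iff₀ hr0]; linarith
  have h3 : (r⁻¹) ^ ⌈1 / (1 - r)⌉₊ ≤ Real.exp 3 :=
    calc (r⁻¹) ^ ⌈1 / (1 - r)⌉₊ ≤ Real.exp ((1 - r) / r) ^ ⌈1 / (1 - r)⌉₊ := by gcongr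
      _ = Real.exp (⌈1 / (1 - r)⌉₊ * ((1 - r) / r)) := (Real.exp_nat_mul _ _).symm
      _ ≤ Real.exp 3 := Real.exp_le_exp.2 h2
  rw [inv_pow, inv_le_iff_one_le_mul₀ (by positivity)] at h3
  exact h3

/-- For `z` with `|φ(z)| = r` near `1` the moment of order `n = ⌈1 / (1 - r)⌉` detects the
size of `Q(z)`: `r ^ n` is bounded below and `sup_s h(s) s ^ n` is at most a multiple of
`h(r)`. -/
lemma IsSlow.boundaryLE_of_limsup_lt {Q : 𝔻 → ℝ} {φ : 𝔻 → 𝔻} {h : ℝ → ℝ} {c C : ℝ}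
    (hh : IsSlow h C) (hQ0 : ∀ z, 0 ≤ Q z)
    (hc : limsup (momentRatio Q φ h) atTop < ENNReal.ofReal c) :
    BoundaryLE Q φ h (Real.exp 3 * C * c) := by
  have hc0 : 0 < c := ENNReal.ofReal_pos.1 (bot_le.trans_lt hc)
  obtain ⟨N, hN⟩ := eventually_atTop.1 (eventually_lt_of_limsup_lt hc)
  refine ⟨max (1 / 2) (1 - 1 / (N + 1)), by positivity, max_lt (by norm_num)
    (by linarith [show (0 : ℝ) < 1 / (N + 1) by positivity]), fun z hz => ?_⟩
  set r := ‖(φ z : ℂ)‖ with hr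
  have hr2 : 1 / 2 < r := (le_max_left _ _).trans_lt hz
  have hr1 : r < 1 := (φ z).norm_lt_one
  have hr' : 0 < 1 - r := by linarith
  have hr0 : 0 < r := by linarith
  set n := ⌈1 / (1 - r)⌉₊ with hn
  have hn1 : 1 / (1 - r) ≤ n := Nat.le_ceil _
  have hNn : N ≤ n := by
    have h1 : 1 - 1 / ((N : ℝ) + 1) < r := (le_max_right _ _).trans_lt hz
    have h2 : (N : ℝ) + 1 ≤ 1 / (1 - r) := by
      rw [le_div_iff₀ hr', ← le_div_iff₀' (by positivity)]; linarith
    have h3 : (N : ℝ) ≤ n := by linarith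
    exact_mod_cast h3
  set D := ⨆ z : 𝔻, ENNReal.ofReal (h ‖(z : ℂ)‖ * ‖(z : ℂ)‖ ^ n) with hD
  have hDle : D ≤ ENNReal.ofReal (C * h r) := iSup_le fun z => ENNReal.ofReal_le_ofReal
    (hh.mul_pow_le hr0.le hr1 (norm_nonneg _) z.norm_lt_one hn1)
  have hDtop : D ≠ ∞ := (hDle.trans_lt ENNReal.ofReal_lt_top).ne
  have hD0 : D ≠ 0 := by
    have : ENNReal.ofReal (h r * r ^ n) ≤ D := by
      rw [hD, hr]
      exact le_iSup (fun z : 𝔻 => ENNReal.ofReal (h ‖(z : ℂ)‖ * ‖(z : ℂ)‖ ^ n)) (φ z)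
    refine (lt_of_lt_of_le (ENNReal.ofReal_pos.2 ?_) this).ne'
    have := hh.pos r hr0.le hr1
    positivity
  have hle : ENNReal.ofReal (Q z * r ^ n) ≤ ENNReal.ofReal (c * (C * h r)) := by
    have h1 := (ENNReal.div_le_iff hD0 hDtop).1 (hN n hNn).le
    rw [ENNReal.ofReal_mul hc0.le]
    exact ((le_iSup (fun z => ENNReal.ofReal (Q z * ‖(φ z : ℂ)‖ ^ n)) z).trans h1).trans
      (by gcongr)
  have hCh : 0 ≤ C * h r := (mul_nonneg (hh.pos 0 le_rfl one_pos).le (pow_nonneg le_rfl n)).trans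
    (hh.mul_pow_le hr0.le hr1 le_rfl one_pos hn1)
  rw [ENNReal.ofReal_le_ofReal_iff (by positivity)] at hle
  calc Q z ≤ Q z * (Real.exp 3 * r ^ n) :=
        le_mul_of_one_le_right (hQ0 z) (one_le_exp_mul_pow hr2.le hr1)
    _ = Real.exp 3 * (Q z * r ^ n) := by ring
    _ ≤ Real.exp 3 * (c * (C * h r)) := by gcongr
    _ = Real.exp 3 * C * c * h r := by ring

/-! ### The two quotients of the theorem as power moments -/

/-- The size `v_log |u'|` of the part `u' · (f ∘ φ)` of `(W_{u,φ} f)'`. -/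
def symbolJ (u : 𝔻 → ℂ) (z : 𝔻) : ℝ := vLog.toFun z * ‖cderiv u z‖

/-- The size `v_log |u φ'|` of the part `u φ' · (f' ∘ φ)` of `(W_{u,φ} f)'`. -/
def symbolI (u : 𝔻 → ℂ) (φ : 𝔻 → 𝔻) (z : 𝔻) : ℝ :=
  vLog.toFun z * ‖u z * cderiv (fun z => (φ z : ℂ)) z‖

lemma symbolJ_nonneg (u : 𝔻 → ℂ) (z : 𝔻) : 0 ≤ symbolJ u z :=
  mul_nonneg (vLog.pos z).le (norm_nonneg _)

lemma symbolI_nonneg (u : 𝔻 → ℂ) (φ : 𝔻 → 𝔻) (z : 𝔻) : 0 ≤ symbolI u φ z :=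
  mul_nonneg (vLog.pos z).le (norm_nonneg _)

lemma blochENorm_of_apply_zero {v : Weight} {f : 𝔻 → ℂ} (h0 : f 0 = 0) :
    blochENorm v f = ⨆ z : 𝔻, ENNReal.ofReal (v.toFun z * ‖cderiv f z‖) := by
  unfold blochENorm
  rw [h0, enorm_zero, zero_add]
  refine iSup_congr fun z => ?_
  rw [ENNReal.ofReal_mul (v.pos z).le, ofReal_norm]

lemma blochENorm_g_succ (v : Weight) (n : ℕ) :
    blochENorm v (g (n + 1))
      = ((n + 1 : ℕ) : ℝ≥0∞) * ⨆ z : 𝔻, ENNReal.ofReal (v.toFun z * ‖(z : ℂ)‖ ^ n) := by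
  rw [blochENorm_of_apply_zero (by simp [g]), ENNReal.mul_iSup]
  refine iSup_congr fun z => ?_
  rw [cderiv_g, ← ENNReal.ofReal_natCast (n + 1), ← ENNReal.ofReal_mul (Nat.cast_nonneg _)]
  congr 1
  simp only [add_tsub_cancel_right, norm_mul, norm_pow, Complex.norm_natCast]
  ring

lemma ratioJ_eq {u : 𝔻 → ℂ} {φ : 𝔻 → 𝔻} (hu : IsHolo u) (hφ : IsHolo fun z => (φ z : ℂ)) (n : ℕ) :
    ratioJ u φ n = momentRatio (symbolJ u) φ wRad n := by
  have hF := (isHolo_powφ hφ n).mul hu.cderiv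
  have h1 : blochENorm vLog (opJ u (powφ φ n))
      = ⨆ z, ENNReal.ofReal (symbolJ u z * ‖(φ z : ℂ)‖ ^ n) := by
    rw [opJ, blochENorm_of_apply_zero (prim_apply_zero _)]
    refine iSup_congr fun z => ?_
    rw [cderiv_prim hF, norm_mul, powφ, norm_pow, symbolJ]
    congr 1; ring
  rw [ratioJ, momentRatio, h1, blochENorm_g_succ, Nat.cast_add, Nat.cast_one,
    ENNReal.mul_div_mul_left _ _ (by simp) (by finiteness)]
  rfl

lemma ratioI_succ_eq {u : 𝔻 → ℂ} {φ : 𝔻 → 𝔻} (hu : IsHolo u) (hφ : IsHolo fun z => (φ z : ℂ))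
    (n : ℕ) : ratioI u φ (n + 1) = momentRatio (symbolI u φ) φ vRad n := by
  have hF := (isHolo_powφ hφ (n + 1)).cderiv.mul hu
  have h1 : blochENorm vLog (opI u (powφ φ (n + 1)))
      = ((n + 1 : ℕ) : ℝ≥0∞) * ⨆ z, ENNReal.ofReal (symbolI u φ z * ‖(φ z : ℂ)‖ ^ n) := by
    rw [opI, blochENorm_of_apply_zero (prim_apply_zero _), ENNReal.mul_iSup]
    refine iSup_congr fun z => ?_
    rw [cderiv_prim hF, cderiv_powφ hφ, symbolI, ← ENNReal.ofReal_natCast (n + 1),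
      ← ENNReal.ofReal_mul (Nat.cast_nonneg _)]
    congr 1
    simp only [add_tsub_cancel_right, norm_mul, norm_pow, Complex.norm_natCast]
    ring
  rw [ratioI, momentRatio, h1, blochENorm_g_succ,
    ENNReal.mul_div_mul_left _ _ (by simp) (by finiteness)]
  rfl

lemma limsup_ratioJ {u : 𝔻 → ℂ} {φ : 𝔻 → 𝔻} (hu : IsHolo u) (hφ : IsHolo fun z => (φ z : ℂ)) :
    limsup (ratioJ u φ) atTop = limsup (momentRatio (symbolJ u) φ wRad) atTop := by
  rw [show ratioJ u φ = momentRatio (symbolJ u) φ wRad from funext (ratioJ_eq hu hφ)]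

lemma limsup_ratioI {u : 𝔻 → ℂ} {φ : 𝔻 → 𝔻} (hu : IsHolo u) (hφ : IsHolo fun z => (φ z : ℂ)) :
    limsup (ratioI u φ) atTop = limsup (momentRatio (symbolI u φ) φ vRad) atTop := by
  rw [← limsup_nat_add (ratioI u φ) 1]
  simp only [ratioI_succ_eq hu hφ]

/-! ### Growth of functions in the logarithmic Bloch space -/

/-- The constant in the growth estimate `|f(z)| ≤ C ‖f‖ / w_log(z)`. -/
def growthConst : ℝ := 1 + (1 - Real.log (Real.log 2)) / Real.log (Real.log 4)

lemma log_two_nonpos : Real.log (Real.log 2) ≤ 0 :=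
  Real.log_nonpos (by positivity) (by linarith [Real.log_two_lt_d9])

lemma growthConst_pos : 0 < growthConst := by
  have := log_two_nonpos
  have := loglog_pos
  unfold growthConst
  have : 0 ≤ (1 - Real.log (Real.log 2)) / Real.log (Real.log 4) := by
    apply div_nonneg <;> linarith
  linarith

lemma Bloch.norm_cderiv_le (f : Bloch vLog) (z : 𝔻) :
    ‖LogBloch.cderiv f z‖ ≤ ‖f‖ / vRad ‖(z : ℂ)‖ := by
  rw [le_div_iff₀' (vRad_pos (norm_nonneg _) z.norm_lt_one)]
  exact f.mul_norm_cderiv_le z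

lemma Bloch.norm_deriv_ext_le (f : Bloch vLog) {w : ℂ} (hw : ‖w‖ < 1) :
    ‖deriv (LogBloch.ext f) w‖ ≤ ‖f‖ / vRad ‖w‖ :=
  f.norm_cderiv_le (UnitDisc.mk w hw)

/-- Integrating `|f'| ≤ ‖f‖ / v_log` along a radius gives the growth `log log`. -/
lemma Bloch.norm_ext_le (f : Bloch vLog) {w : ℂ} (hw : ‖w‖ < 1) :
    ‖LogBloch.ext f w‖ ≤ growthConst * ‖f‖ / wRad ‖w‖ := by
  set r := ‖w‖ with hr
  have hr0 : 0 ≤ r := norm_nonneg w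
  have hnorm : ∀ t : ℝ, 0 ≤ t → ‖(t : ℂ) * w‖ = t * r := fun t ht => by
    rw [norm_mul, norm_real, Real.norm_of_nonneg ht]
  have hlt : ∀ t ∈ Set.Icc (0 : ℝ) 1, t * r < 1 := fun t ht => by nlinarith [ht.1, ht.2]
  have hd : ∀ t ∈ Set.Icc (0 : ℝ) 1, HasDerivAt (fun t : ℝ => LogBloch.ext f ((t : ℂ) * w))
      (deriv (LogBloch.ext f) ((t : ℂ) * w) * w) t := by
    intro t ht
    have h1 : HasDerivAt (fun t : ℝ => (t : ℂ) * w) w t := by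
      simpa using (HasDerivAt.ofReal_comp (hasDerivAt_id t)).mul_const w
    have h2 : (t : ℂ) * w ∈ Metric.ball (0 : ℂ) 1 := by
      rw [mem_ball_zero_iff, hnorm t ht.1]; exact hlt t ht
    exact (DifferentiableOn.differentiableAt f.isHolo
      (Metric.isOpen_ball.mem_nhds h2)).hasDerivAt.comp t h1
  set B : ℝ → ℝ := fun t =>
    ‖f‖ * (1 - Real.log (Real.log 2) + Real.log (Real.log (2 / (1 - t * r)))) with hB
  have hBd : ∀ t ∈ Set.Icc (0 : ℝ) 1, HasDerivAt B (‖f‖ / vRad (t * r) * r) t := by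
    intro t ht
    have hpos : 0 < 1 - t * r := sub_pos.2 (hlt t ht)
    have hl : 0 < Real.log (2 / (1 - t * r)) := (by positivity : 0 < Real.log 2).trans_le
      (log_two_le_log_two_div (mul_nonneg ht.1 hr0) (hlt t ht))
    have h1 : HasDerivAt (fun t : ℝ => 1 - t * r) (-r) t := by
      simpa using ((hasDerivAt_id t).mul_const r).const_sub 1
    have h2 := ((((hasDerivAt_const t (2 : ℝ)).fun_div h1 hpos.ne').log (by positivity)).log
      hl.ne').const_add (1 - Real.log (Real.log 2)) |>.const_mul ‖f‖
    refine h2.congr_deriv ?_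
    unfold vRad
    field_simp
    ring
  have key := image_norm_le_of_norm_deriv_right_le_deriv_boundary' (a := 0) (b := 1)
    (fun t ht => (hd t ht).continuousAt.continuousWithinAt)
    (fun t ht => (hd t (Set.Ico_subset_Icc_self ht)).hasDerivWithinAt) (B := B)
    (by
      have h0 : ‖LogBloch.ext f 0‖ ≤ ‖f‖ := by
        have := f.norm_apply_zero_le
        rwa [← ext_coe f.1 0, UnitDisc.coe_zero] at this
      simpa [hB] using h0)
    (fun t ht => (hBd t ht).continuousAt.continuousWithinAt)
    (fun t ht => (hBd t (Set.Ico_subset_Icc_self ht)).hasDerivWithinAt)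
    (fun t ht => by
      have ht' := Set.Ico_subset_Icc_self ht
      have h1 := f.norm_deriv_ext_le (w := (t : ℂ) * w) (by rw [hnorm t ht.1]; exact hlt t ht')
      rw [hnorm t ht.1] at h1
      rw [norm_mul, ← hr]
      gcongr)
    (Set.right_mem_Icc.2 zero_le_one)
  simp only [ofReal_one, one_mul, hB] at key
  refine key.trans ?_
  set L := Real.log (Real.log (4 / (1 - r ^ 2))) with hL
  have hLc : Real.log (Real.log 4) ≤ L := loglog_four_le hr0 hw
  have hwL : (wRad r)⁻¹ = L := inv_inv _
  rw [div_eq_mul_inv (growthConst * ‖f‖), hwL, mul_comm growthConst, mul_assoc]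
  refine mul_le_mul_of_nonneg_left ?_ (norm_nonneg f)
  have h1 : Real.log (Real.log (2 / (1 - r))) ≤ L := by
    have hpos : 0 < 1 - r := by linarith
    have hl := log_two_le_log_two_div hr0 hw
    refine Real.log_le_log ((by positivity : 0 < Real.log 2).trans_le hl)
      (Real.log_le_log (by positivity) ?_)
    rw [div_le_div_iff₀ hpos (by nlinarith)]
    nlinarith
  have h2 : 1 - Real.log (Real.log 2)
      ≤ (1 - Real.log (Real.log 2)) / Real.log (Real.log 4) * L := by
    have := loglog_pos
    rw [div_mul_eq_mul_div, le_div_iff₀ this]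
    exact mul_le_mul_of_nonneg_left hLc (by linarith [log_two_nonpos])
  unfold growthConst
  linarith

lemma Bloch.norm_ext_le_of_norm_le (f : Bloch vLog) {w : ℂ} {s : ℝ} (hs : s < 1) (hw : ‖w‖ ≤ s) :
    ‖LogBloch.ext f w‖ ≤ growthConst / wRad s * ‖f‖ := by
  refine (f.norm_ext_le (hw.trans_lt hs)).trans ?_
  rw [div_mul_eq_mul_div]
  have := wRad_pos ((norm_nonneg w).trans hw) hs
  have := growthConst_pos
  gcongr
  exact wRad_anti (norm_nonneg _) hs hw

/-! ### Completeness of the logarithmic Bloch space -/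

/-- By the growth estimate a Cauchy sequence converges locally uniformly, so the derivatives
converge as well and the bounds for the weighted derivatives pass to the limit. -/
instance : CompleteSpace (Bloch vLog) := by
  refine Metric.complete_of_cauchySeq_tendsto fun f hf => ?_
  have hval : ∀ (p q : ℕ) (w : ℂ), ‖w‖ < 1 →
      ‖ext (f p) w - ext (f q) w‖ ≤ growthConst * ‖f p - f q‖ / wRad ‖w‖ := by
    intro p q w hw
    have := (f p - f q).norm_ext_le hw
    rwa [Bloch.ext_sub] at this
  have hder : ∀ (p q : ℕ) (z : 𝔻),
      vLog.toFun z * ‖cderiv (f p) z - cderiv (f q) z‖ ≤ ‖f p - f q‖ := by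
    intro p q z
    rw [← Bloch.cderiv_sub]
    exact (f p - f q).mul_norm_cderiv_le z
  rw [Metric.cauchySeq_iff] at hf
  have hconv : ∀ z : 𝔻, ∃ l, Tendsto (fun n => ext (f n) z) atTop (𝓝 l) := by
    intro z
    refine cauchySeq_tendsto_of_complete (Metric.cauchySeq_iff.2 fun ε hε => ?_)
    have hw := wRad_pos (norm_nonneg _) z.norm_lt_one
    have hg := growthConst_pos
    obtain ⟨N, hN⟩ := hf (ε * wRad ‖(z : ℂ)‖ / growthConst) (by positivity)
    refine ⟨N, fun p hp q hq => ?_⟩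
    have h1 := hN p hp q hq
    rw [dist_eq_norm] at h1 ⊢
    refine (hval p q z z.norm_lt_one).trans_lt ?_
    rw [div_lt_iff₀ hw, ← lt_div_iff₀' hg]
    exact h1
  choose F hF using hconv
  have hunif : TendstoLocallyUniformlyOn (fun n => ext (f n)) (ext F) atTop (Metric.ball 0 1) := by
    rw [Metric.tendstoLocallyUniformlyOn_iff]
    intro ε hε x hx
    rw [mem_ball_zero_iff] at hx
    obtain ⟨s, hxs, hs1⟩ := exists_between hx
    have hs0 : 0 ≤ s := (norm_nonneg x).trans hxs.le
    have hw := wRad_pos hs0 hs1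
    have hg := growthConst_pos
    obtain ⟨N, hN⟩ := hf (ε / 2 * wRad s / growthConst) (by positivity)
    refine ⟨Metric.ball 0 s, mem_nhdsWithin_of_mem_nhds
      (Metric.isOpen_ball.mem_nhds (by simpa using hxs)), ?_⟩
    filter_upwards [eventually_ge_atTop N] with n hn y hy
    rw [mem_ball_zero_iff] at hy
    have hy1 := hy.trans hs1
    have hlim : Tendsto (fun q => ‖ext (f n) y - ext (f q) y‖) atTop
        (𝓝 ‖ext (f n) y - ext F y‖) := by
      have := hF (UnitDisc.mk y hy1)
      rw [← ext_coe F, UnitDisc.coe_mk] at this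
      exact (this.const_sub _).norm
    have hle : ‖ext (f n) y - ext F y‖ ≤ ε / 2 := by
      refine le_of_tendsto hlim ?_
      filter_upwards [eventually_ge_atTop N] with q hq
      have h1 := hN n hn q hq
      rw [dist_eq_norm, lt_div_iff₀' hg] at h1
      refine (hval n q y hy1).trans ?_
      have h2 := wRad_anti (norm_nonneg y) hs1 hy.le
      rw [div_le_iff₀ (hw.trans_le h2)]
      nlinarith
    rw [dist_eq_norm, norm_sub_rev]
    linarith
  have hholo : IsHolo F := hunif.differentiableOn
    (Eventually.of_forall fun n => (f n).isHolo) Metric.isOpen_ball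
  have hderiv : ∀ z : 𝔻, Tendsto (fun n => cderiv (f n) z) atTop (𝓝 (cderiv F z)) := fun z =>
    (hunif.deriv (Eventually.of_forall fun n => (f n).isHolo) Metric.isOpen_ball).tendsto_at
      (coe_mem_ball z)
  have hlimder : ∀ ε > 0, ∃ N, ∀ n ≥ N, ∀ z : 𝔻,
      vLog.toFun z * ‖cderiv (f n) z - cderiv F z‖ ≤ ε := by
    intro ε hε
    obtain ⟨N, hN⟩ := hf ε hε
    refine ⟨N, fun n hn z => ?_⟩
    refine le_of_tendsto (((hderiv z).const_sub _).norm.const_mul _) ?_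
    filter_upwards [eventually_ge_atTop N] with q hq
    refine (hder n q z).trans ?_
    have := hN n hn q hq
    rw [dist_eq_norm] at this
    exact this.le
  have hmem : ∃ b : ℝ, ∀ z, vLog.toFun z * ‖cderiv F z‖ ≤ b := by
    obtain ⟨N, hN⟩ := hlimder 1 one_pos
    refine ⟨‖f N‖ + 1, fun z => ?_⟩
    have h1 := hN N le_rfl z
    have h2 := (f N).mul_norm_cderiv_le z
    have h3 := norm_sub_norm_le (cderiv F z) (cderiv (f N) z)
    rw [norm_sub_rev] at h3
    have := vLog.pos z
    nlinarith
  refine ⟨Bloch.mk F hholo hmem, Metric.tendsto_atTop.2 fun ε hε => ?_⟩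
  obtain ⟨N, hN⟩ := hlimder (ε / 3) (by positivity)
  obtain ⟨N', hN'⟩ := Metric.tendsto_atTop.1 (hF 0) (ε / 3) (by positivity)
  refine ⟨max N N', fun n hn => ?_⟩
  rw [dist_eq_norm]
  have h0 : ‖(f n - Bloch.mk F hholo hmem : Bloch vLog).1 0‖ ≤ ε / 3 := by
    have := (hN' n (le_of_max_le_right hn)).le
    rw [dist_eq_norm, ext_coe] at this
    exact this
  have h1 := Bloch.norm_le (f n - Bloch.mk F hholo hmem) h0 (b := ε / 3) fun z => by
    rw [Bloch.cderiv_sub]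
    exact hN n (le_of_max_le_left hn) z
  linarith

/-! ### Finite rank approximation of the identity -/

/-- Cauchy's estimate for the derivative on a smaller disc. -/
lemma norm_deriv_le_of_norm_le {G : ℂ → ℂ} (hG : DifferentiableOn ℂ G (Metric.ball 0 1))
    {r s M : ℝ} (hrs : r < s) (hs : s < 1) (hM : ∀ x, ‖x‖ ≤ s → ‖G x‖ ≤ M) {x : ℂ} (hx : ‖x‖ ≤ r) :
    ‖deriv G x‖ ≤ M / (s - r) := by
  have hsub : Metric.closedBall x (s - r) ⊆ Metric.closedBall 0 s := by
    refine Metric.closedBall_subset_closedBall' ?_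
    rw [dist_zero_right]; linarith
  refine Complex.norm_deriv_le_of_forall_mem_sphere_norm_le (sub_pos.2 hrs) ?_ fun y hy => hM y ?_
  · exact ((hG.mono (Metric.closedBall_subset_ball hs)).mono hsub).diffContOnCl_ball le_rfl
  · simpa using hsub (Metric.sphere_subset_closedBall hy)

/-- Dilations converge to the identity uniformly on compact sets, together with the first
derivatives, with an error controlled by the norm. -/
lemma exists_dilation_close {ρ η : ℝ} (hρ0 : 0 < ρ) (hρ1 : ρ < 1) (hη : 0 < η) :
    ∃ r : ℝ, 0 < r ∧ r < 1 ∧ ∀ (f : Bloch vLog) (w : ℂ), ‖w‖ ≤ ρ →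
      ‖ext f w - ext f (r * w)‖ ≤ η * ‖f‖ ∧
      ‖deriv (ext f) w - r * deriv (ext f) (r * w)‖ ≤ η * ‖f‖ := by
  obtain ⟨s, hρs, hs1⟩ := exists_between hρ1
  have hs0 : 0 < s := hρ0.trans hρs
  have hv := vRad_pos hs0.le hs1
  have hsρ : 0 < s - ρ := sub_pos.2 hρs
  set κ : ℝ := min η (η * (s - ρ)) with hκ
  have hκ0 : 0 < κ := lt_min hη (by positivity)
  obtain ⟨r, hr0, hr1, hr⟩ : ∃ r : ℝ, 0 < r ∧ r < 1 ∧ 2 / vRad s * (1 - r) ≤ κ := by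
    refine ⟨max (1 / 2) (1 - κ * vRad s / 2), by positivity, max_lt (by norm_num) ?_, ?_⟩
    · have : 0 < κ * vRad s / 2 := by positivity
      linarith
    · have := le_max_right (1 / 2) (1 - κ * vRad s / 2)
      calc 2 / vRad s * (1 - max (1 / 2) (1 - κ * vRad s / 2))
          ≤ 2 / vRad s * (κ * vRad s / 2) := by gcongr; linarith
        _ = κ := by field_simp
  refine ⟨r, hr0, hr1, fun f w hw => ?_⟩
  have hrw : ∀ x : ℂ, ‖(r : ℂ) * x‖ = r * ‖x‖ := fun x => by
    rw [norm_mul, norm_real, Real.norm_of_nonneg hr0.le]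
  have hbound : ∀ x : ℂ, ‖x‖ ≤ s → ‖ext f x - ext f (r * x)‖ ≤ κ * ‖f‖ := by
    intro x hx
    have h1 := (convex_closedBall (0 : ℂ) s).norm_image_sub_le_of_norm_deriv_le
      (f := ext f) (C := 2 / vRad s * ‖f‖) (x := r * x) (y := x)
      (fun y hy => DifferentiableOn.differentiableAt f.isHolo
        (Metric.isOpen_ball.mem_nhds (Metric.closedBall_subset_ball hs1 hy)))
      (fun y hy => by
        rw [mem_closedBall_zero_iff] at hy
        refine (f.norm_deriv_ext_le (hy.trans_lt hs1)).trans ?_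
        have h2 := vRad_le_two_mul (norm_nonneg y) hs1 hy
        have h3 := vRad_pos (norm_nonneg y) (hy.trans_lt hs1)
        rw [div_le_iff₀ h3, div_mul_eq_mul_div, div_mul_eq_mul_div, le_div_iff₀ hv]
        nlinarith [norm_nonneg f])
      (by rw [mem_closedBall_zero_iff, hrw]; nlinarith [norm_nonneg x])
      (by simpa using hx)
    have h4 : ‖x - r * x‖ ≤ 1 - r := by
      have : x - r * x = ((1 - r : ℝ) : ℂ) * x := by push_cast; ring
      rw [this, norm_mul, norm_real, Real.norm_of_nonneg (by linarith)]
      exact mul_le_of_le_one_right (by linarith) (hx.trans hs1.le)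
    calc _ ≤ _ := h1
      _ ≤ 2 / vRad s * ‖f‖ * (1 - r) := by gcongr
      _ = 2 / vRad s * (1 - r) * ‖f‖ := by ring
      _ ≤ κ * ‖f‖ := by gcongr
  have hmaps : Set.MapsTo (fun x : ℂ => (r : ℂ) * x) (Metric.ball 0 1) (Metric.ball 0 1) := by
    intro x hx
    rw [mem_ball_zero_iff] at hx ⊢
    rw [hrw]; nlinarith [norm_nonneg x]
  have hhol : DifferentiableOn ℂ (ext f) (Metric.ball 0 1) := f.isHolo
  have hdil : DifferentiableOn ℂ (fun x => ext f (r * x)) (Metric.ball 0 1) :=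
    hhol.comp (g := ext f) (f := fun x : ℂ => (r : ℂ) * x) (by fun_prop) hmaps
  have hwb : w ∈ Metric.ball (0 : ℂ) 1 := by simpa using hw.trans_lt hρ1
  constructor
  · exact (hbound w (hw.trans hρs.le)).trans (by gcongr; exact min_le_left _ _)
  · have h1 := norm_deriv_le_of_norm_le (hhol.sub hdil) hρs hs1 hbound hw
    have h2 : deriv (ext f - fun x => ext f (r * x)) w
        = deriv (ext f) w - r * deriv (ext f) (r * w) := by
      rw [deriv_sub (hhol.differentiableAt (Metric.isOpen_ball.mem_nhds hwb))
        (hdil.differentiableAt (Metric.isOpen_ball.mem_nhds hwb)), deriv_comp_mul_left,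
        smul_eq_mul]
    rw [h2] at h1
    refine h1.trans ?_
    rw [div_le_iff₀ hsρ]
    have : κ ≤ η * (s - ρ) := min_le_right _ _
    nlinarith [norm_nonneg f]

lemma Bloch.contDiffAt_zero (f : Bloch vLog) (k : ℕ) : ContDiffAt ℂ k (LogBloch.ext f) 0 :=
  ((DifferentiableOn.analyticAt f.isHolo
    (Metric.isOpen_ball.mem_nhds (Metric.mem_ball_self one_pos))).contDiffAt)

lemma Bloch.norm_iteratedDeriv_le (f : Bloch vLog) (k : ℕ) {s : ℝ} (hs0 : 0 < s) (hs1 : s < 1) :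
    ‖iteratedDeriv k (LogBloch.ext f) 0‖
      ≤ k.factorial * (growthConst / wRad s * ‖f‖) / s ^ k := by
  refine Complex.norm_iteratedDeriv_le_of_forall_mem_sphere_norm_le k hs0 ?_ fun z hz =>
    f.norm_ext_le_of_norm_le hs1 (by simpa using (mem_sphere_zero_iff_norm.1 hz).le)
  exact (DifferentiableOn.mono f.isHolo (Metric.closedBall_subset_ball hs1)).diffContOnCl_ball
    le_rfl

/-- The `k`-th Taylor coefficient at the origin, a bounded functional on the logarithmic Bloch
space. -/
def taylorCoeff (k : ℕ) : Bloch vLog →L[ℂ] ℂ :=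
  LinearMap.mkContinuous
    { toFun := fun f => (k.factorial : ℂ)⁻¹ * iteratedDeriv k (ext f) 0
      map_add' := fun f h => by
        change _ * iteratedDeriv k (ext (f.1 + h.1)) 0 = _
        rw [ext_add, iteratedDeriv_add (f.contDiffAt_zero k) (h.contDiffAt_zero k), mul_add]
      map_smul' := fun c f => by
        change _ * iteratedDeriv k (ext (c • f.1)) 0 = _
        rw [ext_smul, iteratedDeriv_const_smul_field]
        simp only [smul_eq_mul, RingHom.id_apply]
        ring }
    (growthConst / wRad (1 / 2) / (1 / 2) ^ k) fun f => by
      change ‖(k.factorial : ℂ)⁻¹ * iteratedDeriv k (ext f) 0‖ ≤ _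
      have h := f.norm_iteratedDeriv_le k (s := 1 / 2) (by norm_num) (by norm_num)
      rw [norm_mul, norm_inv, Complex.norm_natCast, inv_mul_le_iff₀ (by positivity)]
      refine h.trans (le_of_eq ?_)
      ring

lemma norm_taylorCoeff_le (k : ℕ) (f : Bloch vLog) {s : ℝ} (hs0 : 0 < s) (hs1 : s < 1) :
    ‖taylorCoeff k f‖ ≤ growthConst / wRad s * ‖f‖ / s ^ k := by
  change ‖(k.factorial : ℂ)⁻¹ * iteratedDeriv k (ext f) 0‖ ≤ _
  rw [norm_mul, norm_inv, Complex.norm_natCast, inv_mul_le_iff₀ (by positivity)]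
  refine (f.norm_iteratedDeriv_le k hs0 hs1).trans (le_of_eq ?_)
  ring

/-- The Taylor polynomial of degree `< N` at the origin. -/
def taylorPoly (N : ℕ) (f : Bloch vLog) (w : ℂ) : ℂ :=
  ∑ k ∈ Finset.range N, taylorCoeff k f * w ^ k

lemma differentiable_taylorPoly (N : ℕ) (f : Bloch vLog) : Differentiable ℂ (taylorPoly N f) := by
  unfold taylorPoly
  fun_prop

lemma hasSum_taylorCoeff (f : Bloch vLog) {w : ℂ} (hw : ‖w‖ < 1) :
    HasSum (fun k => taylorCoeff k f * w ^ k) (ext f w) := by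
  have h := Complex.hasSum_taylorSeries_on_ball (f := ext f) (c := 0) (r := 1) f.isHolo
    (z := w) (by simpa using hw)
  refine (congrArg (HasSum · (ext f w)) (funext fun k => ?_)).mpr h
  change (k.factorial : ℂ)⁻¹ * iteratedDeriv k (ext f) 0 * w ^ k = _
  simp only [sub_zero, smul_eq_mul]
  ring

/-- Taylor polynomials converge uniformly on compact sets, together with the first derivatives,
with an error controlled by the norm. -/
lemma exists_taylorPoly_close {r η : ℝ} (hr0 : 0 < r) (hr1 : r < 1) (hη : 0 < η) :
    ∃ N : ℕ, ∀ (f : Bloch vLog) (w : ℂ), ‖w‖ ≤ r →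
      ‖ext f w - taylorPoly N f w‖ ≤ η * ‖f‖ ∧
      ‖deriv (ext f) w - deriv (taylorPoly N f) w‖ ≤ η * ‖f‖ := by
  obtain ⟨s, hrs, hs1⟩ := exists_between hr1
  obtain ⟨t, hst, ht1⟩ := exists_between hs1
  have hs0 : 0 < s := hr0.trans hrs
  have ht0 : 0 < t := hs0.trans hst
  have hsr : 0 < s - r := sub_pos.2 hrs
  have hq1 : s / t < 1 := (div_lt_one ht0).2 hst
  have hw := wRad_pos ht0.le ht1
  have hg := growthConst_pos
  set κ : ℝ := min η (η * (s - r)) with hκ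
  have hκ0 : 0 < κ := lt_min hη (by positivity)
  have hlim : Tendsto (fun n : ℕ => growthConst / wRad t * (s / t) ^ n / (1 - s / t)) atTop
      (𝓝 0) := by
    simpa using ((tendsto_pow_atTop_nhds_zero_of_lt_one (by positivity) hq1).const_mul
      (growthConst / wRad t)).div_const (1 - s / t)
  obtain ⟨N, hN⟩ := (hlim.eventually (gt_mem_nhds hκ0)).exists
  refine ⟨N, fun f w hwr => ?_⟩
  have hbound : ∀ x : ℂ, ‖x‖ ≤ s → ‖ext f x - taylorPoly N f x‖ ≤ κ * ‖f‖ := by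
    intro x hx
    have h1 := norm_sub_le_of_geometric_bound_of_hasSum hq1
      (C := growthConst / wRad t * ‖f‖) (fun k => by
        rw [norm_mul, norm_pow, div_pow]
        calc ‖taylorCoeff k f‖ * ‖x‖ ^ k ≤ (growthConst / wRad t * ‖f‖ / t ^ k) * s ^ k := by
              gcongr
              exact norm_taylorCoeff_le k f ht0 ht1
          _ = _ := by ring) (hasSum_taylorCoeff f (hx.trans_lt hs1)) N
    rw [norm_sub_rev]
    calc _ ≤ _ := h1
      _ = growthConst / wRad t * (s / t) ^ N / (1 - s / t) * ‖f‖ := by ring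
      _ ≤ κ * ‖f‖ := by gcongr
  have hwb : w ∈ Metric.ball (0 : ℂ) 1 := by simpa using hwr.trans_lt hr1
  have hhol : DifferentiableOn ℂ (ext f) (Metric.ball 0 1) := f.isHolo
  constructor
  · exact (hbound w (hwr.trans hrs.le)).trans (by gcongr; exact min_le_left _ _)
  · have h1 := norm_deriv_le_of_norm_le
      (hhol.sub (differentiable_taylorPoly N f).differentiableOn) hrs hs1 hbound hwr
    rw [deriv_sub (hhol.differentiableAt (Metric.isOpen_ball.mem_nhds hwb))
      (differentiable_taylorPoly N f w)] at h1
    refine h1.trans ?_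
    rw [div_le_iff₀ hsr]
    have : κ ≤ η * (s - r) := min_le_right _ _
    nlinarith [norm_nonneg f]

/-- The monomials as elements of the logarithmic Bloch space. -/
def monomialBloch (k : ℕ) : Bloch vLog :=
  Bloch.mk (g k) (isHolo_g k) ⟨2 * k, fun z => by
    rw [cderiv_g, norm_mul, norm_pow, Complex.norm_natCast, vLog_apply]
    have h1 := vRad_le_two (norm_nonneg _) z.norm_lt_one
    have h2 : ‖(z : ℂ)‖ ^ (k - 1) ≤ 1 := pow_le_one₀ (norm_nonneg _) z.norm_lt_one.le
    calc vRad ‖(z : ℂ)‖ * (k * ‖(z : ℂ)‖ ^ (k - 1)) ≤ 2 * (k * 1) := by gcongr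
      _ = 2 * k := by ring⟩

/-- The finite rank operator sending `f` to the Taylor polynomial of degree `< N` of the
dilation `z ↦ f(r z)`. -/
def dilatedTaylor (r : ℝ) (N : ℕ) : Bloch vLog →L[ℂ] Bloch vLog :=
  ∑ k ∈ Finset.range N, ((r : ℂ) ^ k • taylorCoeff k).smulRight (monomialBloch k)

lemma isCompactOperator_dilatedTaylor (r : ℝ) (N : ℕ) : IsCompactOperator (dilatedTaylor r N) := by
  have h : dilatedTaylor r N ∈ compactOperator (RingHom.id ℂ) (Bloch vLog) (Bloch vLog) := by
    refine Submodule.sum_mem _ fun k _ => ?_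
    exact (isCompactOperator_of_locallyCompactSpace_dom ((r : ℂ) ^ k • taylorCoeff k)).clm_comp
      (ContinuousLinearMap.toSpanSingleton ℂ (monomialBloch k))
  exact h

lemma dilatedTaylor_apply (r : ℝ) (N : ℕ) (f : Bloch vLog) :
    (dilatedTaylor r N f : 𝔻 → ℂ) = fun z : 𝔻 => taylorPoly N f (r * z) := by
  funext z
  let ev : Bloch vLog →+ ℂ :=
    { toFun := fun f => f.1 z, map_zero' := rfl, map_add' := fun _ _ => rfl }
  have h : dilatedTaylor r N f
      = ∑ k ∈ Finset.range N, ((r : ℂ) ^ k * taylorCoeff k f) • monomialBloch k := by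
    simp [dilatedTaylor]
  change ev (dilatedTaylor r N f) = _
  rw [h, map_sum, taylorPoly]
  refine Finset.sum_congr rfl fun k _ => ?_
  change (r : ℂ) ^ k * taylorCoeff k f * (z : ℂ) ^ k = _
  ring

/-- The constant in the bounds for `f - T f`. -/
def approxConst : ℝ := 2 * growthConst + 4 + (Real.log (Real.log 4))⁻¹

lemma approxConst_pos : 0 < approxConst := by
  have := growthConst_pos
  have := inv_pos.2 loglog_pos
  unfold approxConst
  linarith

/-- There are finite rank operators `T` with `f - T f` uniformly small on a given compact
subset of the disc for `‖f‖ ≤ 1`, and bounded in the growth of the space independently of the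
compact set. -/
theorem exists_isCompactOperator_close {ρ ε : ℝ} (hρ0 : 0 < ρ) (hρ1 : ρ < 1) (hε : 0 < ε) :
    ∃ T : Bloch vLog →L[ℂ] Bloch vLog, IsCompactOperator T ∧ ∀ (f : Bloch vLog) (z : 𝔻),
      (‖(z : ℂ)‖ ≤ ρ → ‖(f - T f : Bloch vLog).1 z‖ ≤ ε * ‖f‖ ∧
        ‖cderiv (f - T f : Bloch vLog) z‖ ≤ ε * ‖f‖) ∧
      ‖(f - T f : Bloch vLog).1 z‖ ≤ approxConst * ‖f‖ / wRad ‖(z : ℂ)‖ ∧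
      ‖cderiv (f - T f : Bloch vLog) z‖ ≤ approxConst * ‖f‖ / vRad ‖(z : ℂ)‖ := by
  set η : ℝ := min (ε / 2) (1 / 2) with hη
  have hη0 : 0 < η := by positivity
  have hηε : η ≤ ε / 2 := min_le_left _ _
  have hη1 : η ≤ 1 / 2 := min_le_right _ _
  obtain ⟨r, hr0, hr1, hdil⟩ := exists_dilation_close hρ0 hρ1 hη0
  obtain ⟨N, hN⟩ := exists_taylorPoly_close hr0 hr1 hη0
  refine ⟨dilatedTaylor r N, isCompactOperator_dilatedTaylor r N, fun f z => ?_⟩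
  have hz1 := z.norm_lt_one
  have hz0 := norm_nonneg (z : ℂ)
  have hrz : ‖(r : ℂ) * z‖ = r * ‖(z : ℂ)‖ := by
    rw [norm_mul, norm_real, Real.norm_of_nonneg hr0.le]
  have hrz' : ‖(r : ℂ) * z‖ ≤ r := by rw [hrz]; nlinarith
  have hrz1 : ‖(r : ℂ) * z‖ < 1 := hrz'.trans_lt hr1
  have hrzz : ‖(r : ℂ) * z‖ ≤ ‖(z : ℂ)‖ := by rw [hrz]; nlinarith
  obtain ⟨hp, hp'⟩ := hN f (r * z) hrz'
  have hf := norm_nonneg f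
  have hval : (f - dilatedTaylor r N f : Bloch vLog).1 z
      = (ext f z - ext f (r * z)) + (ext f (r * z) - taylorPoly N f (r * z)) := by
    rw [Bloch.sub_apply, dilatedTaylor_apply, ext_coe (f : 𝔻 → ℂ) z]
    ring
  have hder : cderiv (f - dilatedTaylor r N f : Bloch vLog) z
      = (deriv (ext f) z - r * deriv (ext f) (r * z))
        + r * (deriv (ext f) (r * z) - deriv (taylorPoly N f) (r * z)) := by
    rw [Bloch.cderiv_sub, dilatedTaylor_apply, cderiv_coe (fun w => taylorPoly N f (r * w)),
      deriv_comp_mul_left, smul_eq_mul, cderiv]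
    ring
  have hp'' : ‖r * (deriv (ext f) (r * z) - deriv (taylorPoly N f) (r * z))‖ ≤ η * ‖f‖ := by
    rw [norm_mul, norm_real, Real.norm_of_nonneg hr0.le]
    exact (mul_le_of_le_one_left (norm_nonneg _) hr1.le).trans hp'
  have hw := wRad_pos hz0 hz1
  have hv := vRad_pos hz0 hz1
  refine ⟨fun hzρ => ?_, ?_, ?_⟩
  · obtain ⟨hd, hd'⟩ := hdil f z hzρ
    rw [hval, hder]
    constructor
    · refine (norm_add_le _ _).trans ?_
      nlinarith
    · refine (norm_add_le _ _).trans ?_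
      nlinarith
  · rw [hval, le_div_iff₀ hw]
    have h1 := f.norm_ext_le hz1
    have h2 := f.norm_ext_le hrz1
    have hw2 := wRad_anti (norm_nonneg _) hz1 hrzz
    have hg := growthConst_pos
    have h3 : ‖ext f (r * z)‖ ≤ growthConst * ‖f‖ / wRad ‖(z : ℂ)‖ := h2.trans (by gcongr)
    rw [le_div_iff₀ hw] at h1 h3
    have h4 : η * ‖f‖ * wRad ‖(z : ℂ)‖ ≤ (Real.log (Real.log 4))⁻¹ * ‖f‖ := by
      have := wRad_le hz0 hz1
      calc η * ‖f‖ * wRad ‖(z : ℂ)‖ ≤ 1 * ‖f‖ * (Real.log (Real.log 4))⁻¹ := by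
            gcongr; linarith
        _ = _ := by ring
    calc _ ≤ (‖ext f z‖ + ‖ext f (r * z)‖ + η * ‖f‖) * wRad ‖(z : ℂ)‖ := by
          gcongr
          exact (norm_add_le _ _).trans (add_le_add (norm_sub_le _ _) hp)
      _ ≤ (2 * growthConst + (Real.log (Real.log 4))⁻¹) * ‖f‖ := by linarith
      _ ≤ approxConst * ‖f‖ := by unfold approxConst; gcongr; linarith
  · rw [hder, le_div_iff₀ hv]
    have h1 := f.norm_deriv_ext_le hz1
    have h2 := f.norm_deriv_ext_le hrz1
    have hv2 := vRad_le_two_mul (norm_nonneg _) hz1 hrzz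
    have hv3 := vRad_pos (norm_nonneg _) hrz1
    rw [le_div_iff₀ hv] at h1
    rw [le_div_iff₀ hv3] at h2
    have h3 : ‖r * deriv (ext f) (r * z)‖ * vRad ‖(z : ℂ)‖ ≤ 2 * ‖f‖ := by
      rw [norm_mul, norm_real, Real.norm_of_nonneg hr0.le]
      have := norm_nonneg (deriv (ext f) (r * z))
      calc r * ‖deriv (ext f) (r * z)‖ * vRad ‖(z : ℂ)‖
          ≤ 1 * ‖deriv (ext f) (r * z)‖ * (2 * vRad ‖(r : ℂ) * z‖) := by gcongr
        _ ≤ 2 * ‖f‖ := by linarith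
    have h4 : η * ‖f‖ * vRad ‖(z : ℂ)‖ ≤ ‖f‖ := by
      have := vRad_le_two hz0 hz1
      calc η * ‖f‖ * vRad ‖(z : ℂ)‖ ≤ 1 / 2 * ‖f‖ * 2 := by gcongr
        _ = _ := by ring
    calc _ ≤ (‖deriv (ext f) z‖ + ‖r * deriv (ext f) (r * z)‖ + η * ‖f‖) * vRad ‖(z : ℂ)‖ := by
          gcongr
          exact (norm_add_le _ _).trans (add_le_add (norm_sub_le _ _) hp'')
      _ ≤ 4 * ‖f‖ := by linarith
      _ ≤ approxConst * ‖f‖ := by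
          have := growthConst_pos
          have := inv_pos.2 loglog_pos
          unfold approxConst
          gcongr
          linarith

/-! ### Test functions -/

/-- The inner logarithm `log 8 - log (1 - ā w)` of the test functions; its real part exceeds `1`
on the disc. -/
def innerLog (a : 𝔻) (w : ℂ) : ℂ :=
  (Real.log 8 : ℂ) - Complex.log (1 - (starRingEnd ℂ) (a : ℂ) * w)

/-- The basic test function `log log (8 / (1 - ā w))`. -/
def logLog (a : 𝔻) (w : ℂ) : ℂ := Complex.log (innerLog a w)

/-- The value `log log (8 / (1 - |a|²))` of the test function at `a`. -/
def logLogSelf (a : 𝔻) : ℝ := Real.log (Real.log (8 / (1 - ‖(a : ℂ)‖ ^ 2)))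

section

variable (a : 𝔻) {w : ℂ}

lemma norm_conj_mul (w : ℂ) : ‖(starRingEnd ℂ) (a : ℂ) * w‖ = ‖(a : ℂ)‖ * ‖w‖ := by simp

lemma one_sub_norm_le (w : ℂ) : 1 - ‖w‖ ≤ ‖1 - (starRingEnd ℂ) (a : ℂ) * w‖ := by
  have h := norm_sub_norm_le (1 : ℂ) ((starRingEnd ℂ) (a : ℂ) * w)
  rw [norm_conj_mul, norm_one] at h
  nlinarith [a.norm_lt_one, norm_nonneg w]

lemma one_sub_norm_self_le (hw : ‖w‖ < 1) :
    1 - ‖(a : ℂ)‖ ≤ ‖1 - (starRingEnd ℂ) (a : ℂ) * w‖ := by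
  have h := norm_sub_norm_le (1 : ℂ) ((starRingEnd ℂ) (a : ℂ) * w)
  rw [norm_conj_mul, norm_one] at h
  nlinarith [norm_nonneg (a : ℂ)]

lemma norm_one_sub_le_two (hw : ‖w‖ < 1) : ‖1 - (starRingEnd ℂ) (a : ℂ) * w‖ ≤ 2 := by
  have h := norm_sub_le (1 : ℂ) ((starRingEnd ℂ) (a : ℂ) * w)
  rw [norm_conj_mul, norm_one] at h
  nlinarith [a.norm_lt_one, norm_nonneg w, norm_nonneg (a : ℂ)]

lemma one_sub_mem_slitPlane (hw : ‖w‖ < 1) :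
    1 - (starRingEnd ℂ) (a : ℂ) * w ∈ slitPlane := by
  refine Or.inl ?_
  have h := (abs_re_le_norm ((starRingEnd ℂ) (a : ℂ) * w)).trans_eq (norm_conj_mul a w)
  have h2 := le_abs_self ((starRingEnd ℂ) (a : ℂ) * w).re
  rw [sub_re, one_re]
  nlinarith [a.norm_lt_one, norm_nonneg w, norm_nonneg (a : ℂ)]

lemma norm_one_sub_pos (hw : ‖w‖ < 1) : 0 < ‖1 - (starRingEnd ℂ) (a : ℂ) * w‖ :=
  (by linarith : 0 < 1 - ‖w‖).trans_le (one_sub_norm_le a w)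

lemma innerLog_re (hw : ‖w‖ < 1) :
    (innerLog a w).re = Real.log (8 / ‖1 - (starRingEnd ℂ) (a : ℂ) * w‖) := by
  rw [innerLog, sub_re, log_re, ofReal_re,
    Real.log_div (by norm_num) (norm_one_sub_pos a hw).ne']

lemma one_lt_log_eight_div {x : ℝ} (hx : 0 < x) (hx2 : x ≤ 2) : 1 < Real.log (8 / x) := by
  refine one_lt_log_four.trans_le (Real.log_le_log (by norm_num) ?_)
  rw [le_div_iff₀ hx]; linarith

lemma one_lt_innerLog_re (hw : ‖w‖ < 1) : 1 < (innerLog a w).re := by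
  rw [innerLog_re a hw]
  exact one_lt_log_eight_div (norm_one_sub_pos a hw) (norm_one_sub_le_two a hw)

lemma hasDerivAt_logLog (hw : ‖w‖ < 1) : HasDerivAt (logLog a)
    ((starRingEnd ℂ) (a : ℂ) / (1 - (starRingEnd ℂ) (a : ℂ) * w) / innerLog a w) w := by
  have h1 : HasDerivAt (fun w : ℂ => 1 - (starRingEnd ℂ) (a : ℂ) * w)
      (-(starRingEnd ℂ) (a : ℂ)) w := by
    simpa using ((hasDerivAt_id w).const_mul ((starRingEnd ℂ) (a : ℂ))).const_sub 1
  have h2 : HasDerivAt (innerLog a)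
      ((starRingEnd ℂ) (a : ℂ) / (1 - (starRingEnd ℂ) (a : ℂ) * w)) w := by
    have := (h1.clog (one_sub_mem_slitPlane a hw)).const_sub (Real.log 8 : ℂ)
    rwa [neg_div, neg_neg] at this
  exact h2.clog (Or.inl (zero_lt_one.trans (one_lt_innerLog_re a hw)))

lemma deriv_logLog (hw : ‖w‖ < 1) : deriv (logLog a) w =
    (starRingEnd ℂ) (a : ℂ) / (1 - (starRingEnd ℂ) (a : ℂ) * w) / innerLog a w :=
  (hasDerivAt_logLog a hw).deriv

lemma norm_deriv_logLog_le (hw : ‖w‖ < 1) : ‖deriv (logLog a) w‖ ≤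
    (‖1 - (starRingEnd ℂ) (a : ℂ) * w‖ *
      Real.log (8 / ‖1 - (starRingEnd ℂ) (a : ℂ) * w‖))⁻¹ := by
  have h1 := norm_one_sub_pos a hw
  have h2 := one_lt_innerLog_re a hw
  have h3 := re_le_norm (innerLog a w)
  rw [deriv_logLog a hw, norm_div, norm_div, RCLike.norm_conj, ← innerLog_re a hw, div_div,
    ← one_div]
  have h4 := a.norm_lt_one.le
  gcongr

/-- `t ↦ t log (8 / t)` increases on `(0, 2]`, so that the weighted derivative of the test
function is largest on the radius through `a`. -/
lemma norm_deriv_logLog_le_inv_vRad (hw : ‖w‖ < 1) : ‖deriv (logLog a) w‖ ≤ (vRad ‖w‖)⁻¹ := by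
  refine (norm_deriv_logLog_le a hw).trans (inv_anti₀ (vRad_pos (norm_nonneg _) hw) ?_)
  have hx : 0 < 1 - ‖w‖ := by linarith
  have hy := norm_one_sub_pos a hw
  have hxy := one_sub_norm_le a w
  have hl := one_lt_log_eight_div hy (norm_one_sub_le_two a hw)
  set y := ‖1 - (starRingEnd ℂ) (a : ℂ) * w‖
  calc vRad ‖w‖ ≤ (1 - ‖w‖) * Real.log (8 / (1 - ‖w‖)) := by
        unfold vRad; gcongr; norm_num
    _ ≤ (1 - ‖w‖) * (Real.log (8 / y) + (y / (1 - ‖w‖) - 1)) := by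
        gcongr; exact log_div_le_log_div_add (by norm_num) hx hy
    _ = (1 - ‖w‖) * Real.log (8 / y) + (y - (1 - ‖w‖)) := by field_simp
    _ ≤ y * Real.log (8 / y) := by nlinarith

lemma norm_deriv_logLog_le_inv (hw : ‖w‖ < 1) :
    ‖deriv (logLog a) w‖ ≤ (1 - ‖(a : ℂ)‖)⁻¹ := by
  have ha : 0 < 1 - ‖(a : ℂ)‖ := by linarith [a.norm_lt_one]
  refine (norm_deriv_logLog_le a hw).trans (inv_anti₀ ha ?_)
  have hl := one_lt_log_eight_div (norm_one_sub_pos a hw) (norm_one_sub_le_two a hw)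
  have := one_sub_norm_self_le a hw
  nlinarith

lemma one_lt_log_eight_div_self : 1 < Real.log (8 / (1 - ‖(a : ℂ)‖ ^ 2)) :=
  one_lt_log_eight_div (by linarith [a.sq_norm_lt_one]) (by nlinarith [sq_nonneg ‖(a : ℂ)‖])

lemma inv_wRad_le_logLogSelf : (wRad ‖(a : ℂ)‖)⁻¹ ≤ logLogSelf a := by
  unfold wRad logLogSelf
  rw [inv_inv]
  have h := one_lt_log_div (norm_nonneg (a : ℂ)) a.norm_lt_one
  have h2 : 0 < 1 - ‖(a : ℂ)‖ ^ 2 := by linarith [a.sq_norm_lt_one]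
  refine Real.log_le_log (by linarith) (Real.log_le_log (by positivity) ?_)
  gcongr
  norm_num

lemma loglog_four_le_logLogSelf : Real.log (Real.log 4) ≤ logLogSelf a := by
  refine le_trans ?_ (inv_wRad_le_logLogSelf a)
  unfold wRad
  rw [inv_inv]
  exact loglog_four_le (norm_nonneg _) a.norm_lt_one

lemma logLogSelf_pos : 0 < logLogSelf a := loglog_pos.trans_le (loglog_four_le_logLogSelf a)

lemma one_sub_conj_mul_self :
    1 - (starRingEnd ℂ) (a : ℂ) * a = ((1 - ‖(a : ℂ)‖ ^ 2 : ℝ) : ℂ) := by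
  rw [conj_mul']; push_cast; rfl

lemma innerLog_self : innerLog a a = (Real.log (8 / (1 - ‖(a : ℂ)‖ ^ 2)) : ℂ) := by
  have h2 : 0 < 1 - ‖(a : ℂ)‖ ^ 2 := by linarith [a.sq_norm_lt_one]
  rw [innerLog, one_sub_conj_mul_self, ← ofReal_log h2.le, Real.log_div (by norm_num) h2.ne']
  push_cast; rfl

lemma logLog_self : logLog a a = logLogSelf a := by
  rw [logLog, innerLog_self, logLogSelf,
    ofReal_log (zero_lt_one.trans (one_lt_log_eight_div_self a)).le]

/-- The constant in `|log log (8 / (1 - ā w))| ≤ C log log (8 / (1 - |a|²))`. -/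
def logLogConst : ℝ := 1 + 9 / Real.log (Real.log 4)

lemma logLogConst_pos : 0 < logLogConst := by
  have := loglog_pos
  unfold logLogConst
  positivity

lemma norm_log_le {ζ : ℂ} (h : 1 ≤ ‖ζ‖) : ‖Complex.log ζ‖ ≤ Real.log ‖ζ‖ + 4 := by
  refine (norm_le_abs_re_add_abs_im _).trans ?_
  rw [log_re, log_im, abs_of_nonneg (Real.log_nonneg h)]
  linarith [abs_arg_le_pi ζ, Real.pi_lt_four]

lemma norm_logLog_le (hw : ‖w‖ < 1) : ‖logLog a w‖ ≤ logLogConst * logLogSelf a := by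
  have ha : 0 < 1 - ‖(a : ℂ)‖ := by linarith [a.norm_lt_one]
  have ha2 : 0 < 1 - ‖(a : ℂ)‖ ^ 2 := by linarith [a.sq_norm_lt_one]
  set X := Real.log (8 / (1 - ‖(a : ℂ)‖ ^ 2)) with hX
  have hX1 : 1 < X := one_lt_log_eight_div_self a
  have hre := one_lt_innerLog_re a hw
  have hnorm := re_le_norm (innerLog a w)
  have h1 : (innerLog a w).re ≤ X + 1 := by
    rw [innerLog_re a hw]
    have h2 : 8 / ‖1 - (starRingEnd ℂ) (a : ℂ) * w‖ ≤ 8 / (1 - ‖(a : ℂ)‖ ^ 2) * 2 := by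
      have h3 := one_sub_norm_self_le a hw
      have h4 := norm_one_sub_pos a hw
      rw [div_mul_eq_mul_div, div_le_div_iff₀ h4 ha2]
      nlinarith [a.norm_lt_one, norm_nonneg (a : ℂ)]
    have h5 := Real.log_le_log (div_pos (by norm_num) (norm_one_sub_pos a hw)) h2
    rw [Real.log_mul (by positivity) (by norm_num)] at h5
    linarith [Real.log_two_lt_d9]
  have h6 : ‖innerLog a w‖ ≤ 6 * X := by
    refine (norm_le_abs_re_add_abs_im _).trans ?_
    have h7 : |(innerLog a w).im| ≤ 4 := by
      rw [innerLog, sub_im, ofReal_im, log_im, zero_sub, abs_neg]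
      exact (abs_arg_le_pi _).trans Real.pi_lt_four.le
    rw [abs_of_pos (by linarith)]
    linarith
  have h8 : Real.log ‖innerLog a w‖ ≤ 5 + logLogSelf a := by
    have h9 := Real.log_le_log (by linarith) h6
    rw [Real.log_mul (by norm_num) (by linarith)] at h9
    have h10 := Real.log_le_sub_one_of_pos (show (0 : ℝ) < 6 by norm_num)
    unfold logLogSelf
    linarith
  refine (norm_log_le (by linarith)).trans ?_
  have hc := loglog_pos
  have h11 : 9 ≤ 9 / Real.log (Real.log 4) * logLogSelf a := by
    rw [div_mul_eq_mul_div, le_div_iff₀ hc]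
    linarith [loglog_four_le_logLogSelf a]
  unfold logLogConst
  linarith

lemma norm_logLog_zero_le : ‖logLog a 0‖ ≤ 8 := by
  have h : innerLog a 0 = (Real.log 8 : ℂ) := by simp [innerLog]
  have h8 : 1 < Real.log 8 := one_lt_log_four.trans (Real.log_lt_log (by norm_num) (by norm_num))
  rw [logLog, h, ← ofReal_log (by linarith), norm_real,
    Real.norm_of_nonneg (Real.log_nonneg h8.le)]
  have h1 := Real.log_le_sub_one_of_pos (zero_lt_one.trans h8)
  have h2 := Real.log_le_sub_one_of_pos (show (0 : ℝ) < 8 by norm_num)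
  linarith

lemma inv_vRad_le_norm_deriv_logLog_self (ha : 1 / 2 ≤ ‖(a : ℂ)‖) :
    (12 * vRad ‖(a : ℂ)‖)⁻¹ ≤ ‖deriv (logLog a) a‖ := by
  have ha1 := a.norm_lt_one
  have hp : 0 < 1 - ‖(a : ℂ)‖ := by linarith
  have hp2 : 0 < 1 - ‖(a : ℂ)‖ ^ 2 := by linarith [a.sq_norm_lt_one]
  have hX := one_lt_log_eight_div_self a
  rw [deriv_logLog a ha1, innerLog_self, one_sub_conj_mul_self, norm_div, norm_div,
    RCLike.norm_conj, norm_real, norm_real, Real.norm_of_nonneg hp2.le,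
    Real.norm_of_nonneg (zero_lt_one.trans hX).le, div_div]
  have hv := vRad_pos (norm_nonneg (a : ℂ)) ha1
  have h1 : Real.log (8 / (1 - ‖(a : ℂ)‖ ^ 2)) ≤ 3 * Real.log (2 / (1 - ‖(a : ℂ)‖)) := by
    rw [← Real.log_rpow (by positivity)]
    refine Real.log_le_log (by positivity) ?_
    norm_cast
    rw [div_pow, div_le_div_iff₀ hp2 (by positivity)]
    have : (1 - ‖(a : ℂ)‖) ^ 3 ≤ 1 - ‖(a : ℂ)‖ ^ 2 := by
      have h2 : (1 - ‖(a : ℂ)‖) ^ 3 ≤ (1 - ‖(a : ℂ)‖) ^ 1 :=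
        pow_le_pow_of_le_one hp.le (by linarith) (by norm_num)
      nlinarith
    linarith
  have h2 : (1 - ‖(a : ℂ)‖ ^ 2) * Real.log (8 / (1 - ‖(a : ℂ)‖ ^ 2)) ≤ 6 * vRad ‖(a : ℂ)‖ := by
    calc _ ≤ (2 * (1 - ‖(a : ℂ)‖)) * (3 * Real.log (2 / (1 - ‖(a : ℂ)‖))) := by
          gcongr; nlinarith
      _ = 6 * vRad ‖(a : ℂ)‖ := by unfold vRad; ring
  rw [le_div_iff₀ (by positivity), inv_mul_le_iff₀ (by positivity)]
  nlinarith

/-- The combination `p F + q F² / F(a)` of the basic test function `F` and its square. The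
choice `(p, q) = (2, -1)` gives derivative `0` at `a`, the choice `(-1, 1)` gives value `0`
at `a`. -/
def testFun (p q : ℝ) (w : ℂ) : ℂ := p * logLog a w + q * (logLog a w ^ 2 / logLogSelf a)

variable {p q : ℝ}

lemma hasDerivAt_testFun (hw : ‖w‖ < 1) : HasDerivAt (testFun a p q)
    (deriv (logLog a) w * (p + 2 * q * (logLog a w / logLogSelf a))) w := by
  have h := hasDerivAt_logLog a hw
  rw [← deriv_logLog a hw] at h
  refine ((h.const_mul (p : ℂ)).fun_add
    (((h.fun_pow 2).div_const (logLogSelf a : ℂ)).const_mul (q : ℂ))).congr_deriv ?_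
  push_cast
  ring

lemma norm_logLog_div_le (hw : ‖w‖ < 1) : ‖logLog a w / logLogSelf a‖ ≤ logLogConst := by
  rw [norm_div, norm_real, Real.norm_of_nonneg (logLogSelf_pos a).le,
    div_le_iff₀ (logLogSelf_pos a)]
  exact norm_logLog_le a hw

lemma norm_testFun_le (hp : |p| ≤ 2) (hq : |q| ≤ 2) (hw : ‖w‖ < 1) :
    ‖testFun a p q w‖ ≤ ‖logLog a w‖ * (2 + 2 * logLogConst) := by
  have h1 : testFun a p q w = logLog a w * (p + q * (logLog a w / logLogSelf a)) := by
    unfold testFun; ring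
  rw [h1, norm_mul]
  gcongr
  refine (norm_add_le _ _).trans ?_
  rw [norm_mul, norm_real, norm_real, Real.norm_eq_abs, Real.norm_eq_abs]
  have := norm_logLog_div_le a hw
  gcongr

lemma norm_deriv_testFun_le (hp : |p| ≤ 2) (hq : |q| ≤ 2) (hw : ‖w‖ < 1) :
    ‖deriv (testFun a p q) w‖ ≤ ‖deriv (logLog a) w‖ * (2 + 4 * logLogConst) := by
  rw [(hasDerivAt_testFun a hw).deriv, norm_mul]
  gcongr
  refine (norm_add_le _ _).trans ?_
  rw [norm_mul, norm_mul, norm_real, norm_real, Real.norm_eq_abs, Real.norm_eq_abs, norm_ofNat]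
  have := norm_logLog_div_le a hw
  have h0 := logLogConst_pos
  calc |p| + 2 * |q| * ‖logLog a w / logLogSelf a‖ ≤ 2 + 2 * 2 * logLogConst := by gcongr
    _ = 2 + 4 * logLogConst := by ring

lemma vRad_mul_norm_deriv_testFun_le (hp : |p| ≤ 2) (hq : |q| ≤ 2) (hw : ‖w‖ < 1) :
    vRad ‖w‖ * ‖deriv (testFun a p q) w‖ ≤ 2 + 4 * logLogConst := by
  have h0 := logLogConst_pos
  have hv := vRad_pos (norm_nonneg w) hw
  calc vRad ‖w‖ * ‖deriv (testFun a p q) w‖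
      ≤ vRad ‖w‖ * ((vRad ‖w‖)⁻¹ * (2 + 4 * logLogConst)) := by
        gcongr
        refine (norm_deriv_testFun_le a hp hq hw).trans ?_
        gcongr
        exact norm_deriv_logLog_le_inv_vRad a hw
    _ = 2 + 4 * logLogConst := by field_simp

/-- The test functions as elements of the logarithmic Bloch space. -/
def testBloch (hp : |p| ≤ 2) (hq : |q| ≤ 2) : Bloch vLog :=
  Bloch.mk (fun z => testFun a p q z)
    (isHolo_of_differentiableOn fun _ hw => (hasDerivAt_testFun a
      (mem_ball_zero_iff.1 hw)).differentiableAt.differentiableWithinAt)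
    ⟨2 + 4 * logLogConst, fun z => by
      rw [cderiv_coe (testFun a p q)]
      exact vRad_mul_norm_deriv_testFun_le a hp hq z.norm_lt_one⟩

/-- A bound for the norms of all test functions. -/
def testConst : ℝ := 18 + 20 * logLogConst

lemma testConst_pos : 0 < testConst := by
  have := logLogConst_pos
  unfold testConst; positivity

lemma testBloch_apply (hp : |p| ≤ 2) (hq : |q| ≤ 2) (z : 𝔻) :
    (testBloch a hp hq : 𝔻 → ℂ) z = testFun a p q z := rfl

lemma cderiv_testBloch (hp : |p| ≤ 2) (hq : |q| ≤ 2) (z : 𝔻) :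
    cderiv (testBloch a hp hq) z = deriv (testFun a p q) z :=
  cderiv_coe (testFun a p q) z

lemma norm_testBloch_le (hp : |p| ≤ 2) (hq : |q| ≤ 2) : ‖testBloch a hp hq‖ ≤ testConst := by
  have h := (testBloch a hp hq).norm_le (a := 8 * (2 + 2 * logLogConst))
    (b := 2 + 4 * logLogConst) (by
      rw [testBloch_apply]
      refine (norm_testFun_le a hp hq (by simp)).trans ?_
      have := logLogConst_pos
      gcongr
      exact norm_logLog_zero_le a) (fun z => by
      rw [cderiv_testBloch]
      exact vRad_mul_norm_deriv_testFun_le a hp hq z.norm_lt_one)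
  unfold testConst
  linarith

/-- Each single test function is bounded and has bounded derivative on the disc. -/
lemma exists_testBloch_bound (hp : |p| ≤ 2) (hq : |q| ≤ 2) : ∃ b : ℝ, 0 < b ∧ ∀ z : 𝔻,
    ‖(testBloch a hp hq : 𝔻 → ℂ) z‖ ≤ b ∧ ‖cderiv (testBloch a hp hq) z‖ ≤ b := by
  have h0 := logLogConst_pos
  have h1 := logLogSelf_pos a
  have h2 : 0 < 1 - ‖(a : ℂ)‖ := by linarith [a.norm_lt_one]
  refine ⟨max (logLogConst * logLogSelf a * (2 + 2 * logLogConst))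
    ((1 - ‖(a : ℂ)‖)⁻¹ * (2 + 4 * logLogConst)), by positivity, fun z => ⟨?_, ?_⟩⟩
  · refine le_max_of_le_left ((norm_testFun_le a hp hq z.norm_lt_one).trans ?_)
    gcongr
    exact norm_logLog_le a z.norm_lt_one
  · rw [cderiv_testBloch]
    refine le_max_of_le_right ((norm_deriv_testFun_le a hp hq z.norm_lt_one).trans ?_)
    gcongr
    exact norm_deriv_logLog_le_inv a z.norm_lt_one

lemma testBloch_self (hp : |p| ≤ 2) (hq : |q| ≤ 2) :
    (testBloch a hp hq : 𝔻 → ℂ) a = (p + q) * logLogSelf a := by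
  have : (logLogSelf a : ℂ) ≠ 0 := ofReal_ne_zero.2 (logLogSelf_pos a).ne'
  rw [testBloch_apply, testFun, logLog_self]
  field_simp

lemma cderiv_testBloch_self (hp : |p| ≤ 2) (hq : |q| ≤ 2) :
    cderiv (testBloch a hp hq) a = deriv (logLog a) a * (p + 2 * q) := by
  have : (logLogSelf a : ℂ) ≠ 0 := ofReal_ne_zero.2 (logLogSelf_pos a).ne'
  rw [cderiv_testBloch, (hasDerivAt_testFun a a.norm_lt_one).deriv, logLog_self, div_self this,
    mul_one]

end

/-! ### The essential norm of a weighted composition operator -/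

lemma cderiv_weightedComp {u : 𝔻 → ℂ} {φ : 𝔻 → 𝔻} {f : 𝔻 → ℂ} (hu : IsHolo u)
    (hφ : IsHolo fun z => (φ z : ℂ)) (hf : IsHolo f) (z : 𝔻) :
    cderiv (weightedComp u φ f) z
      = cderiv u z * f (φ z) + u z * cderiv (fun z => (φ z : ℂ)) z * cderiv f (φ z) := by
  unfold weightedComp
  rw [cderiv_mul hu (hf.comp hφ), cderiv_comp hf hφ]
  ring

section

variable {u : 𝔻 → ℂ} {φ : 𝔻 → 𝔻} {W : Bloch vLog →L[ℂ] Bloch vLog}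

lemma cderiv_apply_of_weightedComp (hu : IsHolo u) (hφ : IsHolo fun z => (φ z : ℂ))
    (hW : ∀ f : Bloch vLog, (W f : 𝔻 → ℂ) = weightedComp u φ f) (f : Bloch vLog) (z : 𝔻) :
    cderiv (W f) z = cderiv u z * (f : 𝔻 → ℂ) (φ z)
      + u z * cderiv (fun z => (φ z : ℂ)) z * cderiv f (φ z) := by
  rw [hW]
  exact cderiv_weightedComp hu hφ f.isHolo z

lemma weighted_cderiv_le (hu : IsHolo u) (hφ : IsHolo fun z => (φ z : ℂ))
    (hW : ∀ f : Bloch vLog, (W f : 𝔻 → ℂ) = weightedComp u φ f) (f : Bloch vLog) (z : 𝔻) :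
    vLog.toFun z * ‖cderiv (W f) z‖
      ≤ symbolJ u z * ‖(f : 𝔻 → ℂ) (φ z)‖ + symbolI u φ z * ‖cderiv f (φ z)‖ := by
  rw [cderiv_apply_of_weightedComp hu hφ hW]
  have hv := (vLog.pos z).le
  calc _ ≤ vLog.toFun z * (‖cderiv u z * (f : 𝔻 → ℂ) (φ z)‖
        + ‖u z * cderiv (fun z => (φ z : ℂ)) z * cderiv f (φ z)‖) := by
        gcongr; exact norm_add_le _ _
    _ = _ := by
      rw [norm_mul, norm_mul (u z * _), symbolJ, symbolI]
      ring

/-- Applying `W` to `1` and to `z` shows that both symbols are bounded. -/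
lemma exists_symbol_bound (hu : IsHolo u) (hφ : IsHolo fun z => (φ z : ℂ))
    (hW : ∀ f : Bloch vLog, (W f : 𝔻 → ℂ) = weightedComp u φ f) :
    ∃ M, 0 ≤ M ∧ ∀ z, symbolJ u z ≤ M ∧ symbolI u φ z ≤ M := by
  refine ⟨‖W (monomialBloch 1)‖ + ‖W (monomialBloch 0)‖, by positivity, fun z => ?_⟩
  have hv := vLog.pos z
  have hm : ∀ k, (monomialBloch k : 𝔻 → ℂ) = g k := fun _ => rfl
  have h0 := (W (monomialBloch 0)).mul_norm_cderiv_le z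
  have h1 := (W (monomialBloch 1)).mul_norm_cderiv_le z
  rw [cderiv_apply_of_weightedComp hu hφ hW, hm, cderiv_g] at h0 h1
  simp only [g, pow_zero, Nat.cast_zero, zero_mul, mul_zero, add_zero, mul_one, pow_one,
    Nat.cast_one, Nat.sub_self] at h0 h1
  have hJ : symbolJ u z ≤ ‖W (monomialBloch 0)‖ := h0
  refine ⟨by linarith [norm_nonneg (W (monomialBloch 1))], ?_⟩
  have h2 : ‖u z * cderiv (fun z => (φ z : ℂ)) z‖
      ≤ ‖cderiv u z * (φ z : ℂ) + u z * cderiv (fun z => (φ z : ℂ)) z‖ + ‖cderiv u z‖ := by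
    have h3 := norm_sub_le (cderiv u z * (φ z : ℂ) + u z * cderiv (fun z => (φ z : ℂ)) z)
      (cderiv u z * (φ z : ℂ))
    rw [add_sub_cancel_left] at h3
    have h4 : ‖cderiv u z * (φ z : ℂ)‖ ≤ ‖cderiv u z‖ := by
      rw [norm_mul]
      exact mul_le_of_le_one_right (norm_nonneg _) (φ z).norm_lt_one.le
    linarith
  have h5 := mul_le_mul_of_nonneg_left h2 hv.le
  rw [mul_add] at h5
  unfold symbolI
  linarith

/-- The compact operator `W T`, with `T` a finite rank approximation of the identity, is close
to `W`: where `|φ| ≤ ρ` the functions `f - T f` are small and the symbols bounded, and where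
`|φ| > ρ` the symbols are controlled by the hypotheses. -/
theorem essNorm_le_of_boundaryLE (hu : IsHolo u) (hφ : IsHolo fun z => (φ z : ℂ))
    (hW : ∀ f : Bloch vLog, (W f : 𝔻 → ℂ) = weightedComp u φ f) {c₁ c₂ : ℝ} (hc₁ : 0 ≤ c₁)
    (hc₂ : 0 ≤ c₂) (hJ : BoundaryLE (symbolJ u) φ wRad c₁)
    (hI : BoundaryLE (symbolI u φ) φ vRad c₂) :
    essNorm W ≤ ENNReal.ofReal (approxConst * (c₁ + c₂)) := by
  obtain ⟨ρ₁, hρ₁0, hρ₁1, hρ₁⟩ := hJ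
  obtain ⟨ρ₂, -, hρ₂1, hρ₂⟩ := hI
  obtain ⟨M, hM0, hM⟩ := exists_symbol_bound hu hφ hW
  have hA := approxConst_pos
  set ρ := max (max ρ₁ ρ₂) ‖(φ 0 : ℂ)‖ with hρ
  have hρ0 : 0 < ρ := hρ₁0.trans_le ((le_max_left _ _).trans (le_max_left _ _))
  have hρ1 : ρ < 1 := max_lt (max_lt hρ₁1 hρ₂1) (φ 0).norm_lt_one
  refine ENNReal.le_of_forall_pos_le_add fun δ hδ _ => ?_
  have hδ' : (0 : ℝ) < δ := hδ
  rw [← ENNReal.ofReal_coe_nnreal, ← ENNReal.ofReal_add (by positivity) δ.coe_nonneg]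
  set D := ‖u 0‖ + 2 * M + 1 with hD
  have hD0 : 0 < D := by positivity
  obtain ⟨T, hT, hTf⟩ := exists_isCompactOperator_close hρ0 hρ1 (ε := δ / D) (by positivity)
  refine (iInf₂_le (W.comp T) (hT.clm_comp W)).trans ?_
  rw [← ofReal_norm]
  refine ENNReal.ofReal_le_ofReal (ContinuousLinearMap.opNorm_le_bound _ (by positivity)
    fun f => ?_)
  have hWE : (W - W.comp T) f = W (f - T f) := by simp
  rw [hWE]
  set E := f - T f with hE
  have hf := norm_nonneg f
  have hδD : 0 ≤ δ / D * ‖f‖ := by positivity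
  have h0 : ‖(W E : 𝔻 → ℂ) 0‖ ≤ ‖u 0‖ * (δ / D * ‖f‖) := by
    rw [hW, weightedComp, norm_mul]
    gcongr
    exact ((hTf f (φ 0)).1 (le_max_right _ _)).1
  have h1 : ∀ z, vLog.toFun z * ‖cderiv (W E) z‖
      ≤ approxConst * (c₁ + c₂) * ‖f‖ + 2 * M * (δ / D * ‖f‖) := by
    intro z
    refine (weighted_cderiv_le hu hφ hW E z).trans ?_
    have hJ0 := symbolJ_nonneg u z
    have hI0 := symbolI_nonneg u φ z
    have hnn : 0 ≤ approxConst * (c₁ + c₂) * ‖f‖ := by positivity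
    rcases le_or_gt ‖(φ z : ℂ)‖ ρ with hz | hz
    · obtain ⟨hs, hs'⟩ := (hTf f (φ z)).1 hz
      calc _ ≤ M * (δ / D * ‖f‖) + M * (δ / D * ‖f‖) := by
            gcongr
            · exact (hM z).1
            · exact (hM z).2
        _ ≤ _ := by linarith
    · obtain ⟨hb, hb'⟩ := (hTf f (φ z)).2
      have hw := wRad_pos (norm_nonneg _) (φ z).norm_lt_one
      have hv := vRad_pos (norm_nonneg _) (φ z).norm_lt_one
      have e1 := hρ₁ z (((le_max_left _ _).trans (le_max_left _ _)).trans_lt hz)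
      have e2 := hρ₂ z (((le_max_right _ _).trans (le_max_left _ _)).trans_lt hz)
      have hnn2 : 0 ≤ 2 * M * (δ / D * ‖f‖) := by positivity
      calc _ ≤ c₁ * wRad ‖(φ z : ℂ)‖ * (approxConst * ‖f‖ / wRad ‖(φ z : ℂ)‖)
            + c₂ * vRad ‖(φ z : ℂ)‖ * (approxConst * ‖f‖ / vRad ‖(φ z : ℂ)‖) := by gcongr
        _ = approxConst * (c₁ + c₂) * ‖f‖ := by field_simp
        _ ≤ _ := by linarith
  refine ((W E).norm_le h0 h1).trans ?_
  have h2 : (‖u 0‖ + 2 * M) * (δ / D * ‖f‖) ≤ δ * ‖f‖ := by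
    calc _ ≤ D * (δ / D * ‖f‖) := by gcongr; linarith
      _ = δ * ‖f‖ := by field_simp
  linarith

/-- Let `F a` be a bounded family whose members satisfy `v_log |(W F a)'| → 0` as `|φ| → 1`. By
compactness of `K` the differences `K (F a - F b)` are small along a subsequence of any
sequence of parameters, so near the boundary the weighted derivative of `W F (φ z)` at `z` is
controlled by the distance of `W` to `K`. -/
theorem exists_annulus_weighted_cderiv_le {F : 𝔻 → Bloch vLog} {M c : ℝ}
    (hF : ∀ a, ‖F a‖ ≤ M)
    (hvan : ∀ a, ∀ ε > 0, ∃ ρ < 1, ∀ z, ρ < ‖(φ z : ℂ)‖ → vLog.toFun z * ‖cderiv (W (F a)) z‖ < ε)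
    {K : Bloch vLog →L[ℂ] Bloch vLog} (hK : IsCompactOperator K) (hc : ‖W - K‖ < c) :
    ∃ ρ < 1, ∀ z, ρ < ‖(φ z : ℂ)‖ →
      vLog.toFun z * ‖cderiv (W (F (φ z))) z‖ ≤ (2 * M + 1) * c := by
  have hc0 : 0 < c := (norm_nonneg _).trans_lt hc
  by_contra! hcon
  have hseq : ∀ k : ℕ, ∃ z, 1 - 1 / ((k : ℝ) + 1) < ‖(φ z : ℂ)‖ ∧
      (2 * M + 1) * c < vLog.toFun z * ‖cderiv (W (F (φ z))) z‖ := fun k =>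
    hcon _ (by linarith [show (0 : ℝ) < 1 / (k + 1) by positivity])
  choose z hz hbig using hseq
  obtain ⟨S, hS, hSK⟩ := hK.image_closedBall_subset_compact (f := (K : Bloch vLog →ₗ[ℂ] Bloch vLog))
    M
  obtain ⟨l, -, σ, hσ, hl⟩ := hS.tendsto_subseq (x := fun k => K (F (φ (z k)))) fun k =>
    hSK ⟨F (φ (z k)), by simpa using hF _, rfl⟩
  obtain ⟨N, hN⟩ := Metric.cauchySeq_iff.1 hl.cauchySeq (c / 2) (by positivity)
  obtain ⟨ρ, hρ1, hρ⟩ := hvan (φ (z (σ N))) (c / 2) (by positivity)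
  have hlim : Tendsto (fun k => 1 - 1 / ((σ k : ℝ) + 1)) atTop (𝓝 1) := by
    simpa using (tendsto_one_div_add_atTop_nhds_zero_nat.comp hσ.tendsto_atTop).const_sub (1 : ℝ)
  obtain ⟨k, hkN, hkρ⟩ := ((eventually_ge_atTop N).and
    (hlim.eventually (lt_mem_nhds hρ1))).exists
  -- far out along the sequence the fixed function `W (F (φ (z (σ N))))` contributes little
  have e1 := hρ (z (σ k)) (hkρ.trans (hz (σ k)))
  have e2 := hbig (σ k)
  have e3 := hN k hkN N le_rfl
  rw [dist_eq_norm] at e3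
  set fk := F (φ (z (σ k)))
  set fN := F (φ (z (σ N)))
  set x := z (σ k)
  have e3' : ‖K fk - K fN‖ < c / 2 := e3
  have e4 := (W (fk - fN)).mul_norm_cderiv_le x
  have e5 : ‖W (fk - fN)‖ ≤ c * (2 * M) + c / 2 := by
    have h1 : W (fk - fN) = (W - K) (fk - fN) + (K fk - K fN) := by simp
    rw [h1]
    refine (norm_add_le _ _).trans (add_le_add ?_ e3'.le)
    refine ((W - K).le_opNorm _).trans ?_
    have h2 : ‖fk - fN‖ ≤ 2 * M :=
      (norm_sub_le _ _).trans (by linarith [hF (φ x), hF (φ (z (σ N)))])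
    gcongr
  have e6 : vLog.toFun x * ‖cderiv (W fk) x‖
      ≤ vLog.toFun x * ‖cderiv (W (fk - fN)) x‖ + vLog.toFun x * ‖cderiv (W fN) x‖ := by
    rw [← mul_add]
    refine mul_le_mul_of_nonneg_left ?_ (vLog.pos x).le
    rw [map_sub, Bloch.cderiv_sub]
    simpa using norm_add_le (cderiv (W fk) x - cderiv (W fN) x) (cderiv (W fN) x)
  linarith

lemma abs_neg_one_le_two : |(-1 : ℝ)| ≤ 2 := by norm_num

lemma abs_one_le_two : |(1 : ℝ)| ≤ 2 := by norm_num

lemma abs_two_le_two : |(2 : ℝ)| ≤ 2 := by norm_num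

/-- The test function at `a` with vanishing derivative there. -/
def testValue (a : 𝔻) : Bloch vLog := testBloch a abs_two_le_two abs_neg_one_le_two

/-- The test function at `a` vanishing there. -/
def testDeriv (a : 𝔻) : Bloch vLog := testBloch a abs_neg_one_le_two abs_one_le_two

lemma symbolJ_le_mul_wRad (hu : IsHolo u) (hφ : IsHolo fun z => (φ z : ℂ))
    (hW : ∀ f : Bloch vLog, (W f : 𝔻 → ℂ) = weightedComp u φ f) (z : 𝔻) :
    symbolJ u z ≤ vLog.toFun z * ‖cderiv (W (testValue (φ z))) z‖ * wRad ‖(φ z : ℂ)‖ := by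
  have hw := wRad_pos (norm_nonneg _) (φ z).norm_lt_one
  have hΛ := inv_wRad_le_logLogSelf (φ z)
  rw [cderiv_apply_of_weightedComp hu hφ hW, testValue, testBloch_self, cderiv_testBloch_self]
  have h1 : ((2 : ℝ) : ℂ) + ((-1 : ℝ) : ℂ) = 1 := by push_cast; ring
  have h2 : ((2 : ℝ) : ℂ) + 2 * ((-1 : ℝ) : ℂ) = 0 := by push_cast; ring
  rw [h1, h2, one_mul, mul_zero, mul_zero, add_zero, norm_mul, norm_real,
    Real.norm_of_nonneg (logLogSelf_pos _).le, ← mul_assoc]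
  change symbolJ u z ≤ symbolJ u z * logLogSelf (φ z) * wRad ‖(φ z : ℂ)‖
  rw [mul_assoc]
  refine le_mul_of_one_le_right (symbolJ_nonneg u z) ?_
  rwa [inv_le_iff_one_le_mul₀ hw] at hΛ

lemma symbolI_le_mul_vRad (hu : IsHolo u) (hφ : IsHolo fun z => (φ z : ℂ))
    (hW : ∀ f : Bloch vLog, (W f : 𝔻 → ℂ) = weightedComp u φ f) (z : 𝔻)
    (hz : 1 / 2 ≤ ‖(φ z : ℂ)‖) :
    symbolI u φ z
      ≤ vLog.toFun z * ‖cderiv (W (testDeriv (φ z))) z‖ * (12 * vRad ‖(φ z : ℂ)‖) := by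
  have hv := vRad_pos (norm_nonneg _) (φ z).norm_lt_one
  have hd := inv_vRad_le_norm_deriv_logLog_self (φ z) hz
  rw [cderiv_apply_of_weightedComp hu hφ hW, testDeriv, testBloch_self, cderiv_testBloch_self]
  have h1 : ((-1 : ℝ) : ℂ) + ((1 : ℝ) : ℂ) = 0 := by push_cast; ring
  have h2 : ((-1 : ℝ) : ℂ) + 2 * ((1 : ℝ) : ℂ) = 1 := by push_cast; ring
  rw [h1, h2, zero_mul, mul_zero, mul_one, zero_add, norm_mul, ← mul_assoc (vLog.toFun z)]
  change symbolI u φ z ≤ symbolI u φ z * ‖deriv (logLog (φ z)) (φ z)‖ * (12 * vRad ‖(φ z : ℂ)‖)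
  rw [mul_assoc]
  refine le_mul_of_one_le_right (symbolI_nonneg u φ z) ?_
  rwa [inv_le_iff_one_le_mul₀ (by positivity)] at hd

/-- Both symbols vanish at the boundary, hence so does the weighted derivative of `W f` for
each function `f` bounded together with its derivative. -/
lemma exists_annulus_weighted_cderiv_lt (hu : IsHolo u) (hφ : IsHolo fun z => (φ z : ℂ))
    (hW : ∀ f : Bloch vLog, (W f : 𝔻 → ℂ) = weightedComp u φ f) (f : Bloch vLog) {b : ℝ}
    (hb : 0 < b) (hf : ∀ z, ‖(f : 𝔻 → ℂ) z‖ ≤ b ∧ ‖cderiv f z‖ ≤ b) {ε : ℝ} (hε : 0 < ε) :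
    ∃ ρ < 1, ∀ z, ρ < ‖(φ z : ℂ)‖ → vLog.toFun z * ‖cderiv (W f) z‖ < ε := by
  have ht := testConst_pos
  set κ := ε / (2 * b * (‖W‖ * testConst + 1)) with hκ
  have hL : 0 < ‖W‖ * testConst + 1 := by positivity
  have hκ0 : 0 < κ := by positivity
  obtain ⟨ρ₁, -, hρ₁1, hρ₁⟩ := exists_annulus_lt tendsto_wRad hκ0
  obtain ⟨ρ₂, -, hρ₂1, hρ₂⟩ := exists_annulus_lt tendsto_vRad (ε := κ / 12) (by positivity)
  refine ⟨max (max ρ₁ ρ₂) (1 / 2), max_lt (max_lt hρ₁1 hρ₂1) (by norm_num), fun z hz => ?_⟩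
  have hz1 := (φ z).norm_lt_one
  have hw := hρ₁ _ (((le_max_left _ _).trans (le_max_left _ _)).trans_lt hz) hz1
  have hv := hρ₂ _ (((le_max_right _ _).trans (le_max_left _ _)).trans_lt hz) hz1
  have hw0 := wRad_pos (norm_nonneg _) hz1
  have hv0 := vRad_pos (norm_nonneg _) hz1
  have hnorm : ∀ h : Bloch vLog, ‖h‖ ≤ testConst →
      vLog.toFun z * ‖cderiv (W h) z‖ ≤ ‖W‖ * testConst := fun h hh =>
    ((W h).mul_norm_cderiv_le z).trans ((W.le_opNorm h).trans (by gcongr))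
  have hJ : symbolJ u z ≤ ‖W‖ * testConst * κ := by
    refine (symbolJ_le_mul_wRad hu hφ hW z).trans ?_
    exact mul_le_mul (hnorm _ (norm_testBloch_le _ _ _)) hw.le hw0.le (by positivity)
  have hI : symbolI u φ z ≤ ‖W‖ * testConst * κ := by
    refine (symbolI_le_mul_vRad hu hφ hW z ((le_max_right _ _).trans hz.le)).trans ?_
    exact mul_le_mul (hnorm _ (norm_testBloch_le _ _ _)) (by linarith) (by positivity)
      (by positivity)
  calc _ ≤ symbolJ u z * ‖(f : 𝔻 → ℂ) (φ z)‖ + symbolI u φ z * ‖cderiv f (φ z)‖ :=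
        weighted_cderiv_le hu hφ hW f z
    _ ≤ ‖W‖ * testConst * κ * b + ‖W‖ * testConst * κ * b := by
        gcongr
        · exact (hf _).1
        · exact (hf _).2
    _ < (‖W‖ * testConst + 1) * κ * b + (‖W‖ * testConst + 1) * κ * b := by
        have : 0 < κ * b := by positivity
        nlinarith
    _ = ε := by rw [hκ]; field_simp; ring

/-- The two families of test functions recover the two symbols from the weighted derivative of
`W f`: one removes the term with `f'`, the other the term with `f`. -/
theorem boundaryLE_of_essNorm_lt (hu : IsHolo u) (hφ : IsHolo fun z => (φ z : ℂ))
    (hW : ∀ f : Bloch vLog, (W f : 𝔻 → ℂ) = weightedComp u φ f) {c : ℝ}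
    (hc : essNorm W < ENNReal.ofReal c) :
    BoundaryLE (symbolJ u) φ wRad ((2 * testConst + 1) * c) ∧
      BoundaryLE (symbolI u φ) φ vRad (12 * (2 * testConst + 1) * c) := by
  have ht := testConst_pos
  obtain ⟨K, hK⟩ := iInf_lt_iff.1 hc
  obtain ⟨hKc, hK⟩ := iInf_lt_iff.1 hK
  rw [← ofReal_norm, ENNReal.ofReal_lt_ofReal_iff_of_nonneg (norm_nonneg _)] at hK
  constructor
  · obtain ⟨ρ, hρ1, hρ⟩ := exists_annulus_weighted_cderiv_le (φ := φ) (F := testValue)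
      (fun a => norm_testBloch_le a _ _) (fun a ε hε => by
        obtain ⟨b, hb, hb'⟩ := exists_testBloch_bound a abs_two_le_two abs_neg_one_le_two
        exact exists_annulus_weighted_cderiv_lt hu hφ hW _ hb hb' hε) hKc hK
    refine ⟨max ρ (1 / 2), by positivity, max_lt hρ1 (by norm_num), fun z hz => ?_⟩
    have hw0 := wRad_pos (norm_nonneg _) (φ z).norm_lt_one
    refine (symbolJ_le_mul_wRad hu hφ hW z).trans ?_
    exact mul_le_mul_of_nonneg_right (hρ z ((le_max_left _ _).trans_lt hz)) hw0.le
  · obtain ⟨ρ, hρ1, hρ⟩ := exists_annulus_weighted_cderiv_le (φ := φ) (F := testDeriv)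
      (fun a => norm_testBloch_le a _ _) (fun a ε hε => by
        obtain ⟨b, hb, hb'⟩ := exists_testBloch_bound a abs_neg_one_le_two abs_one_le_two
        exact exists_annulus_weighted_cderiv_lt hu hφ hW _ hb hb' hε) hKc hK
    refine ⟨max ρ (1 / 2), by positivity, max_lt hρ1 (by norm_num), fun z hz => ?_⟩
    have hv0 := vRad_pos (norm_nonneg _) (φ z).norm_lt_one
    calc _ ≤ _ := symbolI_le_mul_vRad hu hφ hW z ((le_max_right _ _).trans hz.le)
      _ ≤ (2 * testConst + 1) * c * (12 * vRad ‖(φ z : ℂ)‖) := by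
          exact mul_le_mul_of_nonneg_right (hρ z ((le_max_left _ _).trans_lt hz)) (by positivity)
      _ = _ := by ring

/-- The constant in the upper estimate of the essential norm. -/
def upperConst : ℝ := approxConst * (Real.exp 3 * ((Real.log (Real.log 4))⁻¹ + 2))

/-- The constant in the lower estimate of the essential norm. -/
def lowerConst : ℝ := 12 * (2 * testConst + 1)

lemma upperConst_pos : 0 < upperConst := by
  have := approxConst_pos
  have := loglog_pos
  unfold upperConst
  positivity

lemma lowerConst_pos : 0 < lowerConst := by
  have := testConst_pos
  unfold lowerConst
  positivity

/-- If `x ≤ K c` for every real `c` above `y`, then `x ≤ K y`. -/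
lemma le_ofReal_mul_of_forall_lt {x y : ℝ≥0∞} {K : ℝ} (hK : 0 < K)
    (h : ∀ c : ℝ, y < ENNReal.ofReal c → x ≤ ENNReal.ofReal (K * c)) :
    x ≤ ENNReal.ofReal K * y := by
  have hK0 : ENNReal.ofReal K ≠ 0 := (ENNReal.ofReal_pos.2 hK).ne'
  rw [mul_comm, ← ENNReal.div_le_iff hK0 ENNReal.ofReal_ne_top]
  refine le_of_forall_gt_imp_ge_of_dense fun b hb => ?_
  rcases eq_or_ne b ∞ with rfl | hbt
  · exact le_top
  rw [ENNReal.div_le_iff hK0 ENNReal.ofReal_ne_top, mul_comm]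
  rw [← ENNReal.ofReal_toReal hbt] at hb ⊢
  rw [← ENNReal.ofReal_mul hK.le]
  exact h _ hb

theorem essNorm_le_upperConst_mul (hu : IsHolo u) (hφ : IsHolo fun z => (φ z : ℂ))
    (hW : ∀ f : Bloch vLog, (W f : 𝔻 → ℂ) = weightedComp u φ f) :
    essNorm W ≤ ENNReal.ofReal upperConst *
      max (limsup (ratioJ u φ) atTop) (limsup (ratioI u φ) atTop) := by
  refine le_ofReal_mul_of_forall_lt upperConst_pos fun c hc => ?_
  have hc0 : 0 < c := ENNReal.ofReal_pos.1 (bot_le.trans_lt hc)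
  rw [limsup_ratioJ hu hφ, limsup_ratioI hu hφ, max_lt_iff] at hc
  have hl := loglog_pos
  refine (essNorm_le_of_boundaryLE hu hφ hW (by positivity) (by positivity)
    (isSlow_wRad.boundaryLE_of_limsup_lt (symbolJ_nonneg u) hc.1)
    (isSlow_vRad.boundaryLE_of_limsup_lt (symbolI_nonneg u φ) hc.2)).trans_eq ?_
  unfold upperConst
  congr 1
  ring

theorem max_limsup_le_lowerConst_mul (hu : IsHolo u) (hφ : IsHolo fun z => (φ z : ℂ))
    (hW : ∀ f : Bloch vLog, (W f : 𝔻 → ℂ) = weightedComp u φ f) :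
    max (limsup (ratioJ u φ) atTop) (limsup (ratioI u φ) atTop)
      ≤ ENNReal.ofReal lowerConst * essNorm W := by
  refine le_ofReal_mul_of_forall_lt lowerConst_pos fun c hc => ?_
  have hc0 : 0 < c := ENNReal.ofReal_pos.1 (bot_le.trans_lt hc)
  have ht := testConst_pos
  obtain ⟨M, -, hM⟩ := exists_symbol_bound hu hφ hW
  obtain ⟨hJ, hI⟩ := boundaryLE_of_essNorm_lt hu hφ hW hc
  rw [limsup_ratioJ hu hφ, limsup_ratioI hu hφ]
  refine max_le ?_ ?_
  · refine (hJ.limsup_momentRatio_le (fun _ => wRad_pos) (fun z => (hM z).1)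
      (by positivity)).trans (ENNReal.ofReal_le_ofReal ?_)
    unfold lowerConst
    gcongr
    linarith
  · unfold lowerConst
    exact hI.limsup_momentRatio_le (fun _ => vRad_pos) (fun z => (hM z).2) (by positivity)

end

lemma essNorm_eq_zero_iff {X Y : Type*} [NormedAddCommGroup X] [NormedSpace ℂ X]
    [NormedAddCommGroup Y] [NormedSpace ℂ Y] [CompleteSpace Y] (T : X →L[ℂ] Y) :
    essNorm T = 0 ↔ IsCompactOperator T := by
  constructor
  · intro h
    have hcl : IsClosed {K : X →L[ℂ] Y | IsCompactOperator K} :=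
      isClosed_setOfPred_isCompactOperator
    change T ∈ {K : X →L[ℂ] Y | IsCompactOperator K}
    rw [← hcl.closure_eq, Metric.mem_closure_iff]
    intro ε hε
    have h1 : essNorm T < ENNReal.ofReal ε := by rw [h]; exact ENNReal.ofReal_pos.2 hε
    obtain ⟨K, hK⟩ := iInf_lt_iff.1 h1
    obtain ⟨hKc, hK⟩ := iInf_lt_iff.1 hK
    refine ⟨K, hKc, ?_⟩
    rwa [← ofReal_norm, ENNReal.ofReal_lt_ofReal_iff hε, ← dist_eq_norm] at hK
  · intro h
    refine le_antisymm ((iInf₂_le T h).trans ?_) bot_le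
    rw [sub_self, ← ofReal_norm, norm_zero, ENNReal.ofReal_zero]

lemma tendsto_zero_iff_limsup_eq_zero {x : ℕ → ℝ≥0∞} :
    Tendsto x atTop (𝓝 0) ↔ limsup x atTop = 0 :=
  ⟨fun h => h.limsup_eq, fun h => tendsto_of_le_liminf_of_limsup_le bot_le h.le⟩

end LogBloch

end

theorem mainTheorem1 :
    ∃ C : ℝ≥0, 0 < C ∧
      ∀ (u : 𝔻 → ℂ) (φ : 𝔻 → 𝔻),
        LogBloch.IsHolo u → LogBloch.IsHolo (fun z => (φ z : ℂ)) →
        -- `W` is the continuous operator induced by `W_{u,φ}` on the logarithmic Bloch space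
        ∀ W : LogBloch.Bloch LogBloch.vLog →L[ℂ] LogBloch.Bloch LogBloch.vLog,
          (∀ f : LogBloch.Bloch LogBloch.vLog,
            (W f : 𝔻 → ℂ) = LogBloch.weightedComp u φ f) →
          ((C : ℝ≥0∞)⁻¹ * LogBloch.essNorm W ≤
              max (limsup (LogBloch.ratioJ u φ) atTop) (limsup (LogBloch.ratioI u φ) atTop) ∧
            max (limsup (LogBloch.ratioJ u φ) atTop) (limsup (LogBloch.ratioI u φ) atTop) ≤
              (C : ℝ≥0∞) * LogBloch.essNorm W) ∧
          (IsCompactOperator W ↔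
            Tendsto (LogBloch.ratioJ u φ) atTop (𝓝 0) ∧
            Tendsto (LogBloch.ratioI u φ) atTop (𝓝 0)) := by
  have hU := LogBloch.upperConst_pos
  refine ⟨(max LogBloch.upperConst LogBloch.lowerConst).toNNReal,
    Real.toNNReal_pos.2 (lt_max_of_lt_left hU), fun u φ hu hφ W hW => ?_⟩
  have hup := LogBloch.essNorm_le_upperConst_mul hu hφ hW
  have hlow := LogBloch.max_limsup_le_lowerConst_mul hu hφ hW
  change ((ENNReal.ofReal (max LogBloch.upperConst LogBloch.lowerConst))⁻¹ * _ ≤ _ ∧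
    _ ≤ ENNReal.ofReal (max LogBloch.upperConst LogBloch.lowerConst) * _) ∧ _
  refine ⟨⟨?_, hlow.trans (by gcongr; exact le_max_right _ _)⟩, ?_⟩
  · rw [mul_comm, ← div_eq_mul_inv]
    refine ENNReal.div_le_of_le_mul' (hup.trans ?_)
    gcongr
    exact le_max_left _ _
  · rw [← LogBloch.essNorm_eq_zero_iff, LogBloch.tendsto_zero_iff_limsup_eq_zero,
      LogBloch.tendsto_zero_iff_limsup_eq_zero]
    constructor
    · intro h
      rw [h, mul_zero] at hlow
      exact ⟨le_antisymm ((le_max_left _ _).trans hlow) bot_le,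
        le_antisymm ((le_max_right _ _).trans hlow) bot_le⟩
    · rintro ⟨h1, h2⟩
      rw [h1, h2, max_self, mul_zero] at hup
      exact le_antisymm hup bot_le
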